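/- **Model.** Let $K\ge 1$ and $M,P,L,N$ be integers, $T=LN$ (so $N=T/L$). Let $a:\mathbb R\to\mathbb C^M$ be an array manifold, $0\le c_1<\dots<c_P\le L-1$ integers, $l_1,\dots,l_K\in\{1,\dots,L\}$ the occupied sub-bands, $\phi=(\phi_1,\dots,\phi_K)\in\mathbb R^K$ the spatial phases with $a$ differentiable at each $\phi_k$, and $\bar S(f)\in\mathbb C^K$, $f=1,\dots,N$, the deterministic signal values. Put $$A=[a(\phi_1),\dots,a(\phi_K)],\quad D=[a'(\phi_1),\dots,a'(\phi_K)],\quad B_{il}=\tfrac1{\sqrt L}e^{\,j2\pi c_i l/L},\quad B_\Omega=[B^{l_1},\dots,B^{l_K}],$$ where $B^{l}$ is the $l$-th column of the $P\times L$ matrix $B$, and, with $*$ the Khatri–Rao (column-wise Kronecker) product, $G=A*B_\Omega$ and $E=D*B_\Omega$. The data are $$Y(f)=G\,\bar S(f)+(I_M\otimes B)\,n(f),\qquad f=1,\dots,N,$$ where all $ML$ entries of all $n(f)$ are independent circular complex Gaussian variables with mean $0$ and variance $\sigma^2>0$. Let $$R_{\bar S}=\frac1{T/L}\sum_{f=1}^{T/L}\bar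 S(f)\bar S(f)^{H},\qquad P_G=I-G(G^HG)^{-1}G^H,$$ and assume that $G^HG$ and $\Re\big((E^HP_GE)\odot R_{\bar S}^{T}\big)$ are invertible. The Cramér–Rao bound (CRB) for $\phi$ is the $\phi$-block of the inverse of the Fisher information matrix $\mathbb E[\partial_i\ln L\,\partial_j\ln L]$ of the data law with respect to the real parameters $\phi$, $\Re\bar S(f)$, $\Im\bar S(f)$ ($f=1,\dots,N$); the noise variance $\sigma^2$ either is known or is one more unknown parameter. **Claim.** 1. For all values of the parameters the data have a density with respect to Lebesgue measure, with logarithm $$\ln L=-NMP\ln(\pi\sigma^2)-\frac1{\sigma^2}\sum_{f=1}^{T/L}\big(Y(f)-G\bar S(f)\big)^H\big(Y(f)-G\bar S(f)\big).$$ 2. The $k$-th column of $E$ is the derivative with respect to $\phi_k$ of the $k$-th column of $G$. 3. Whether $\sigma^2$ is known or unknown, the Fisher information matrix is well defined (the log-likelihood has all partial derivatives there and their products are integrable) and invertible, and in both cases the CRB for $\phi$ is $$\mathrm{CRB}_{sub}=\frac{\sigma^2}{2T/L}\Big(\Re\big((E^HP_GE)\odot R_{\bar S}^{T}\big)\Big)^{-1}=\frac{\sigma^2}{2T}\Big(\Re\big((E^HP_GE)\odot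 R_S^{T}\big)\Big)^{-1},\qquad R_S=\tfrac1L R_{\bar S}.$$ 4. Suppose that the signals are uncorrelated, i.e. $R_{\bar S}$ is diagonal. Let $S$ be the full-band spectrum, whose $k$-th entry at frequency $f$ of sub-band $l$ is $\bar S_k(f)$ if $l=l_k$ and $0$ otherwise. Then the Nyquist-rate autocorrelation matrix $R_S=\frac1T\sum S S^H$ (sum over all $T$ frequencies) equals $\frac1L R_{\bar S}$, and $$\mathrm{CRB}_{sub}=\frac{\sigma^2}{2T/L}\Big(\Re\big((E^HP_GE)\odot R_{\bar S}^{H}\big)\Big)^{-1}=\frac{\sigma^2}{2T}\Big(\Re\big((E^HP_GE)\odot R_S^{H}\big)\Big)^{-1}.$$ -/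

import Mathlib

open MeasureTheory
open scoped Matrix Kronecker

noncomputable section

namespace SubNyquist

/-! ### General notions -/

/-- Khatri-Rao (column-wise Kronecker) product. -/
def khatriRao {m p k : Type*} (A : Matrix m k ℂ) (B : Matrix p k ℂ) : Matrix (m × p) k ℂ :=
  Matrix.of fun i j => A i.1 j * B i.2 j

/-- The centred circular complex Gaussian law on `ℂ` with variance `v = E|z|²`. -/
def complexGaussian (v : ℝ) : Measure ℂ :=
  (volume : Measure ℂ).withDensity fun z =>
    ENNReal.ofReal ((Real.pi * v)⁻¹ * Real.exp (-(‖z‖ ^ 2 / v)))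

/-- Score: the partial derivative of the log-likelihood `ℓ` in the `i`-th real parameter. -/
def score {ι 𝓨 : Type*} [DecidableEq ι] (ℓ : (ι → ℝ) → 𝓨 → ℝ) (θ : ι → ℝ) (i : ι) (y : 𝓨) : ℝ :=
  deriv (fun x : ℝ => ℓ (Function.update θ i x) y) (θ i)

/-- Fisher information matrix `E_θ[∂ᵢ ℓ ∂ⱼ ℓ]` of the family of laws `Q` with log-likelihood `ℓ`. -/
def fisherInformation {ι 𝓨 : Type*} [DecidableEq ι] [MeasurableSpace 𝓨]
    (Q : (ι → ℝ) → Measure 𝓨) (ℓ : (ι → ℝ) → 𝓨 → ℝ) (θ : ι → ℝ) : Matrix ι ι ℝ :=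
  Matrix.of fun i j => ∫ y, score ℓ θ i y * score ℓ θ j y ∂(Q θ)

/-- The Fisher information at `θ` is well defined and nonsingular: the log-likelihood has all
partial derivatives, the products of scores are integrable, and the matrix is invertible. -/
def FisherRegular {ι 𝓨 : Type*} [Fintype ι] [DecidableEq ι] [MeasurableSpace 𝓨]
    (Q : (ι → ℝ) → Measure 𝓨) (ℓ : (ι → ℝ) → 𝓨 → ℝ) (θ : ι → ℝ) : Prop :=
  (∀ y i, DifferentiableAt ℝ (fun x : ℝ => ℓ (Function.update θ i x) y) (θ i)) ∧
  (∀ i j, Integrable (fun y => score ℓ θ i y * score ℓ θ j y) (Q θ)) ∧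
  IsUnit (fisherInformation Q ℓ θ).det

/-- Cramér-Rao bound for the subvector of parameters selected by `e`: the corresponding diagonal
block of the inverse of the full Fisher information matrix (all others are nuisance parameters). -/
def cramerRaoBound {ι κ 𝓨 : Type*} [Fintype ι] [DecidableEq ι] [MeasurableSpace 𝓨]
    (Q : (ι → ℝ) → Measure 𝓨) (ℓ : (ι → ℝ) → 𝓨 → ℝ) (e : κ → ι) (θ : ι → ℝ) : Matrix κ κ ℝ :=
  ((fisherInformation Q ℓ θ)⁻¹).submatrix e e

/-! ### The time-space union reception model -/

section model

variable {K L M P N : ℕ}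

/-- Array manifold matrix `A = [a(φ₁), …, a(φ_K)]`. -/
def arrayMatrix (a : ℝ → Fin M → ℂ) (φ : Fin K → ℝ) : Matrix (Fin M) (Fin K) ℂ :=
  Matrix.of fun m k => a (φ k) m

/-- `D = [da/dφ(φ₁), …, da/dφ(φ_K)]`. -/
def arrayDerivMatrix (a : ℝ → Fin M → ℂ) (φ : Fin K → ℝ) : Matrix (Fin M) (Fin K) ℂ :=
  Matrix.of fun m k => deriv a (φ k) m

/-- Normalised multi-coset matrix `B_{il} = L^{-1/2} exp(j 2π c_i l / L)`, `l = 1, …, L`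
(the element `l` of `Fin L` stands for the sub-band with number `l + 1`). -/
def samplingMatrix (c : Fin P → Fin L) : Matrix (Fin P) (Fin L) ℂ :=
  Matrix.of fun i l => ((Real.sqrt L : ℝ) : ℂ)⁻¹ *
    Complex.exp (Complex.I * (2 * Real.pi / L) * ((c i : ℕ) : ℂ) * (((l : ℕ) : ℂ) + 1))

/-- `B_Ω`: the columns of `B` that belong to the occupied sub-bands `l₁, …, l_K`. -/
def activeSamplingMatrix (c : Fin P → Fin L) (Ω : Fin K → Fin L) : Matrix (Fin P) (Fin K) ℂ :=
  (samplingMatrix c).submatrix id Ω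

/-- `G_S = A ∗ B_Ω`. -/
def unionMatrix (a : ℝ → Fin M → ℂ) (c : Fin P → Fin L) (Ω : Fin K → Fin L) (φ : Fin K → ℝ) :
    Matrix (Fin M × Fin P) (Fin K) ℂ :=
  khatriRao (arrayMatrix a φ) (activeSamplingMatrix c Ω)

/-- `E = D ∗ B_Ω`. -/
def unionDerivMatrix (a : ℝ → Fin M → ℂ) (c : Fin P → Fin L) (Ω : Fin K → Fin L)
    (φ : Fin K → ℝ) : Matrix (Fin M × Fin P) (Fin K) ℂ :=
  khatriRao (arrayDerivMatrix a φ) (activeSamplingMatrix c Ω)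

/-- `I_B = I_M ⊗ B`, through which the noise enters. -/
def noiseMatrix (M : ℕ) (c : Fin P → Fin L) : Matrix (Fin M × Fin P) (Fin M × Fin L) ℂ :=
  (1 : Matrix (Fin M) (Fin M) ℂ) ⊗ₖ samplingMatrix c

/-- `P_G = I - G G†` with `G† = (Gᴴ G)⁻¹ Gᴴ`. -/
def orthProj {m k : Type*} [Fintype m] [DecidableEq m] [Fintype k] [DecidableEq k]
    (G : Matrix m k ℂ) : Matrix m m ℂ :=
  1 - G * ((Gᴴ * G)⁻¹ * Gᴴ)

/-- `Re ((Eᴴ P_G E) ⊙ R)`. -/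
def infoMatrix (a : ℝ → Fin M → ℂ) (c : Fin P → Fin L) (Ω : Fin K → Fin L) (φ : Fin K → ℝ)
    (R : Matrix (Fin K) (Fin K) ℂ) : Matrix (Fin K) (Fin K) ℝ :=
  (((unionDerivMatrix a c Ω φ)ᴴ * orthProj (unionMatrix a c Ω φ) * unionDerivMatrix a c Ω φ) ⊙
    R).map Complex.re

/-- Signal autocorrelation `R_{S̄} = (1/N) ∑_f s(f) s(f)ᴴ` over the `N = T/L` sub-Nyquist
snapshots. -/
def subAutocorrelation (s : Fin N → Fin K → ℂ) : Matrix (Fin K) (Fin K) ℂ :=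
  (N : ℂ)⁻¹ • ∑ f, Matrix.vecMulVec (s f) (star (s f))

/-- The spectrum on the whole Nyquist band, at frequency `f` of sub-band `l`: signal `k` occupies
the sub-band `Ω k` only, where it is `s f k`. -/
def fullSpectrum (Ω : Fin K → Fin L) (s : Fin N → Fin K → ℂ) (q : Fin L × Fin N) : Fin K → ℂ :=
  fun k => if q.1 = Ω k then s q.2 k else 0

/-- Signal autocorrelation `R_S = (1/T) ∑_f S(f) S(f)ᴴ` over the `T = L N` Nyquist snapshots. -/
def nyquistAutocorrelation (Ω : Fin K → Fin L) (s : Fin N → Fin K → ℂ) :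
    Matrix (Fin K) (Fin K) ℂ :=
  ((L : ℂ) * N)⁻¹ • ∑ q, Matrix.vecMulVec (fullSpectrum Ω s q) (star (fullSpectrum Ω s q))

/-- Law of the data `Y(f) = G_S s(f) + I_B n(f)`, `f = 1, …, N`, where the `n(f)` are independent
and each `n(f)` has `M L` independent circular complex Gaussian entries of variance `v`. -/
def observationLaw (a : ℝ → Fin M → ℂ) (c : Fin P → Fin L) (Ω : Fin K → Fin L)
    (v : ℝ) (φ : Fin K → ℝ) (s : Fin N → Fin K → ℂ) : Measure (Fin N → Fin M × Fin P → ℂ) :=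
  (Measure.pi fun _ : Fin N => Measure.pi fun _ : Fin M × Fin L => complexGaussian v).map
    fun n f => unionMatrix a c Ω φ *ᵥ s f + noiseMatrix M c *ᵥ n f

/-- Log-likelihood `- N M P log (π v) - v⁻¹ ∑_f ‖y(f) - G_S s(f)‖²` of the data `y`. -/
def logLikelihood (a : ℝ → Fin M → ℂ) (c : Fin P → Fin L) (Ω : Fin K → Fin L)
    (v : ℝ) (φ : Fin K → ℝ) (s : Fin N → Fin K → ℂ) (y : Fin N → Fin M × Fin P → ℂ) : ℝ :=
  -((N : ℝ) * M * P) * Real.log (Real.pi * v) -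
    v⁻¹ * ∑ f, ∑ i, ‖y f i - (unionMatrix a c Ω φ *ᵥ s f) i‖ ^ 2

/-- Index set of the real parameters: spatial phases, real parts and imaginary parts of the
deterministic signal values. -/
abbrev ParamIdx (K N : ℕ) : Type := Fin K ⊕ ((Fin N × Fin K) ⊕ (Fin N × Fin K))

/-- The phases encoded in a parameter vector. -/
def phasesOf (θ : ParamIdx K N → ℝ) : Fin K → ℝ := fun k => θ (Sum.inl k)

/-- The signal values encoded in a parameter vector. -/
def signalsOf (θ : ParamIdx K N → ℝ) : Fin N → Fin K → ℂ :=
  fun f k => ⟨θ (Sum.inr (Sum.inl (f, k))), θ (Sum.inr (Sum.inr (f, k)))⟩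

/-- The parameter vector of phases `φ` and signals `s`. -/
def paramVec (φ : Fin K → ℝ) (s : Fin N → Fin K → ℂ) : ParamIdx K N → ℝ :=
  Sum.elim φ (Sum.elim (fun q => (s q.1 q.2).re) fun q => (s q.1 q.2).im)

/-- Parametric family with known noise variance `v`. -/
def lawKnownVar (a : ℝ → Fin M → ℂ) (c : Fin P → Fin L) (Ω : Fin K → Fin L) (v : ℝ)
    (θ : ParamIdx K N → ℝ) : Measure (Fin N → Fin M × Fin P → ℂ) :=
  observationLaw a c Ω v (phasesOf θ) (signalsOf θ)

/-- Log-likelihood with known noise variance `v`. -/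
def logLikKnownVar (a : ℝ → Fin M → ℂ) (c : Fin P → Fin L) (Ω : Fin K → Fin L) (v : ℝ)
    (θ : ParamIdx K N → ℝ) (y : Fin N → Fin M × Fin P → ℂ) : ℝ :=
  logLikelihood a c Ω v (phasesOf θ) (signalsOf θ) y

/-- Parametric family whose last parameter is the unknown noise variance. -/
def lawUnknownVar (a : ℝ → Fin M → ℂ) (c : Fin P → Fin L) (Ω : Fin K → Fin L)
    (θ : ParamIdx K N ⊕ Unit → ℝ) : Measure (Fin N → Fin M × Fin P → ℂ) :=
  lawKnownVar a c Ω (θ (Sum.inr ())) fun i => θ (Sum.inl i)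

/-- Log-likelihood with the noise variance as last parameter. -/
def logLikUnknownVar (a : ℝ → Fin M → ℂ) (c : Fin P → Fin L) (Ω : Fin K → Fin L)
    (θ : ParamIdx K N ⊕ Unit → ℝ) (y : Fin N → Fin M × Fin P → ℂ) : ℝ :=
  logLikKnownVar a c Ω (θ (Sum.inr ())) (fun i => θ (Sum.inl i)) y

/-- Cramér-Rao bound for the spatial phases, signals unknown, noise variance `v` known. -/
def phaseCRBKnownVar (a : ℝ → Fin M → ℂ) (c : Fin P → Fin L) (Ω : Fin K → Fin L) (v : ℝ)
    (φ : Fin K → ℝ) (s : Fin N → Fin K → ℂ) : Matrix (Fin K) (Fin K) ℝ :=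
  cramerRaoBound (lawKnownVar a c Ω v) (logLikKnownVar a c Ω v) Sum.inl (paramVec φ s)

/-- Cramér-Rao bound for the spatial phases, signals and noise variance unknown, at the value `v`
of the noise variance. -/
def phaseCRBUnknownVar (a : ℝ → Fin M → ℂ) (c : Fin P → Fin L) (Ω : Fin K → Fin L) (v : ℝ)
    (φ : Fin K → ℝ) (s : Fin N → Fin K → ℂ) : Matrix (Fin K) (Fin K) ℝ :=
  cramerRaoBound (lawUnknownVar a c Ω) (logLikUnknownVar a c Ω) (fun k => Sum.inl (Sum.inl k))
    (Sum.elim (paramVec φ s) fun _ => v)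

end model

end SubNyquist

end

open SubNyquist

noncomputable section

namespace SubNyquist

/-! ### The complex Gaussian law -/

section gaussian

open ProbabilityTheory

/-! The rows of the sampling matrix are distinct rows of the unitary `L`-point Fourier matrix, and
the law of a white circular Gaussian vector is invariant under unitaries. Hence the received noise
is again white with variance `v` on `M P` channels, which gives the density, and the residual `Y - G
S` has a law independent of the phases and signals.

Consequently a score in a phase or signal coordinate is `2/v` times the real inner product of the
residual with the derivative of the mean in that coordinate. Since `E[Re⟨z,d⟩ Re⟨z,e⟩] = (v/2)
Re⟨d,e⟩`, the Fisher matrix is `2/v` times the real Gram matrix of the Jacobian `[Z, W, iW]`, where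
`Z` holds the phase derivatives and `W = I_N ⊗ G`. The columns `W, iW` span over the reals the
complex range of `W`, so the Schur complement (`inv_realGram_submatrix`) replaces `Z` by its
projection off that range. As `W` is block diagonal over snapshots, this leaves `∑_f conj(s_k(f))
s_{k'}(f) (Eᴴ P_G E)_{kk'}`, that is `N` times the Hadamard product with the transposed
autocorrelation (`phaseJacobian_schur`).

The score of an unknown variance is even in the residual and the other scores are odd; the Fisher
matrix is then block diagonal and the phase block of its inverse does not change. -/

theorem map_withDensity_comp {α β : Type*} [MeasurableSpace α] [MeasurableSpace β]
    (μ : Measure α) {e : α → β} (he : Measurable e) {g : β → ENNReal} (hg : Measurable g) :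
    (μ.withDensity fun x => g (e x)).map e = (μ.map e).withDensity g := by
  ext t ht
  rw [Measure.map_apply he ht, withDensity_apply _ (he ht), withDensity_apply _ ht,
    setLIntegral_map ht hg he]

/-- A product measure is determined on boxes, where Fubini factorises the integral. Integrability
allows passing to Bochner integrals, to which the finite-product formula applies. -/
theorem pi_withDensity_ofReal {ι E : Type*} [Fintype ι] [MeasurableSpace E] (μ : Measure E)
    [SigmaFinite μ] {f : ι → E → ℝ} (hf : ∀ i, Integrable (f i) μ) (h0 : ∀ i x, 0 ≤ f i x) :
    (Measure.pi fun i => μ.withDensity fun x => ENNReal.ofReal (f i x)) =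
      (Measure.pi fun _ : ι => μ).withDensity fun x => ENNReal.ofReal (∏ i, f i (x i)) := by
  have hfin : ∀ i, IsFiniteMeasure (μ.withDensity fun x => ENNReal.ofReal (f i x)) := fun i =>
    isFiniteMeasure_withDensity_ofReal (hf i).2
  refine Measure.pi_eq fun t ht => ?_
  rw [withDensity_apply _ (MeasurableSet.univ_pi ht), Measure.restrict_pi_pi,
    ← ofReal_integral_eq_lintegral_ofReal (.fintype_prod fun i => (hf i).restrict)
      (ae_of_all _ fun x => Finset.prod_nonneg fun i _ => h0 i _),
    integral_fintype_prod_eq_prod (fun i => f i),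
    ENNReal.ofReal_prod_of_nonneg fun i _ => integral_nonneg (h0 i)]
  refine Finset.prod_congr rfl fun i _ => ?_
  rw [withDensity_apply _ (ht i),
    ofReal_integral_eq_lintegral_ofReal (hf i).restrict (ae_of_all _ (h0 i))]

/-- Circularity in real coordinates: the planar density factorises into two centred real Gaussians
of variance `v/2`. All moments below reduce to one-dimensional ones through this. -/
theorem complexGaussian_eq_map {v : ℝ} (hv : 0 < v) :
    complexGaussian v = ((gaussianReal 0 (v / 2).toNNReal).prod
      (gaussianReal 0 (v / 2).toNNReal)).map Complex.measurableEquivRealProd.symm := by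
  have hv2 : (v / 2).toNNReal ≠ 0 := by simpa using hv
  have hc : ((v / 2).toNNReal : ℝ) = v / 2 := Real.coe_toNNReal _ (by positivity)
  rw [gaussianReal_of_var_ne_zero _ hv2,
    prod_withDensity (measurable_gaussianPDF _ _) (measurable_gaussianPDF _ _), complexGaussian,
    ← (Complex.volume_preserving_equiv_real_prod.symm).map_eq,
    ← map_withDensity_comp _ (MeasurableEquiv.measurable _) (by fun_prop)]
  congr 2
  ext p
  have hn : ‖Complex.measurableEquivRealProd.symm p‖ ^ 2 = p.1 ^ 2 + p.2 ^ 2 := by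
    rw [Complex.measurableEquivRealProd_symm_apply, Complex.sq_norm, Complex.normSq_mk]
    ring
  rw [gaussianPDF, gaussianPDF, ← ENNReal.ofReal_mul (gaussianPDFReal_nonneg _ _ _), hn]
  congr 1
  simp only [gaussianPDFReal, hc]
  have : Real.sqrt (2 * Real.pi * (v / 2)) ^ 2 = Real.pi * v := by
    rw [Real.sq_sqrt (by positivity)]; ring
  rw [mul_mul_mul_comm, ← Real.exp_add, ← mul_inv, ← sq, this]
  congr 2
  field_simp
  ring

theorem isProbabilityMeasure_complexGaussian {v : ℝ} (hv : 0 < v) :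
    IsProbabilityMeasure (complexGaussian v) := by
  rw [complexGaussian_eq_map hv]
  exact Measure.isProbabilityMeasure_map (MeasurableEquiv.measurable _).aemeasurable

theorem measurePreserving_complexGaussian {v : ℝ} (hv : 0 < v) :
    MeasurePreserving Complex.measurableEquivRealProd (complexGaussian v)
      ((gaussianReal 0 (v / 2).toNNReal).prod (gaussianReal 0 (v / 2).toNNReal)) := by
  refine MeasurePreserving.symm Complex.measurableEquivRealProd.symm ⟨MeasurableEquiv.measurable _, ?_⟩
  rw [complexGaussian_eq_map hv]

theorem measurePreserving_re_complexGaussian {v : ℝ} (hv : 0 < v) :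
    MeasurePreserving Complex.re (complexGaussian v) (gaussianReal 0 (v / 2).toNNReal) :=
  measurePreserving_fst.comp (measurePreserving_complexGaussian hv)

theorem measurePreserving_im_complexGaussian {v : ℝ} (hv : 0 < v) :
    MeasurePreserving Complex.im (complexGaussian v) (gaussianReal 0 (v / 2).toNNReal) :=
  measurePreserving_snd.comp (measurePreserving_complexGaussian hv)

theorem memLp_re_complexGaussian {v : ℝ} (hv : 0 < v) {p : ENNReal} (hp : p ≠ ⊤) :
    MemLp Complex.re p (complexGaussian v) :=
  (memLp_id_gaussianReal' p hp).comp_measurePreserving (measurePreserving_re_complexGaussian hv)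

theorem memLp_im_complexGaussian {v : ℝ} (hv : 0 < v) {p : ENNReal} (hp : p ≠ ⊤) :
    MemLp Complex.im p (complexGaussian v) :=
  (memLp_id_gaussianReal' p hp).comp_measurePreserving (measurePreserving_im_complexGaussian hv)

theorem integral_gaussianReal_sq (w : NNReal) : ∫ x, x ^ 2 ∂gaussianReal 0 w = w := by
  have h := variance_id_gaussianReal (μ := 0) (v := w)
  rw [variance_eq_sub (memLp_id_gaussianReal 2)] at h
  simpa using h

theorem integral_re_complexGaussian {v : ℝ} (hv : 0 < v) :
    ∫ z, z.re ∂complexGaussian v = 0 := by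
  have h := integral_id_gaussianReal (μ := 0) (v := (v / 2).toNNReal)
  rw [← (measurePreserving_re_complexGaussian hv).map_eq,
    integral_map Complex.measurable_re.aemeasurable (by fun_prop)] at h
  exact h

theorem integral_im_complexGaussian {v : ℝ} (hv : 0 < v) :
    ∫ z, z.im ∂complexGaussian v = 0 := by
  have h := integral_id_gaussianReal (μ := 0) (v := (v / 2).toNNReal)
  rw [← (measurePreserving_im_complexGaussian hv).map_eq,
    integral_map Complex.measurable_im.aemeasurable (by fun_prop)] at h
  exact h

theorem integral_re_sq_complexGaussian {v : ℝ} (hv : 0 < v) :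
    ∫ z, z.re ^ 2 ∂complexGaussian v = v / 2 := by
  have h := integral_gaussianReal_sq (v / 2).toNNReal
  rw [← (measurePreserving_re_complexGaussian hv).map_eq,
    integral_map Complex.measurable_re.aemeasurable (by fun_prop),
    Real.coe_toNNReal _ (by positivity)] at h
  exact h

theorem integral_im_sq_complexGaussian {v : ℝ} (hv : 0 < v) :
    ∫ z, z.im ^ 2 ∂complexGaussian v = v / 2 := by
  have h := integral_gaussianReal_sq (v / 2).toNNReal
  rw [← (measurePreserving_im_complexGaussian hv).map_eq,
    integral_map Complex.measurable_im.aemeasurable (by fun_prop),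
    Real.coe_toNNReal _ (by positivity)] at h
  exact h

theorem integral_re_mul_im_complexGaussian {v : ℝ} (hv : 0 < v) :
    ∫ z, z.re * z.im ∂complexGaussian v = 0 := by
  have h := integral_prod_mul (μ := gaussianReal 0 (v / 2).toNNReal)
    (ν := gaussianReal 0 (v / 2).toNNReal) (id : ℝ → ℝ) id
  rw [← (measurePreserving_complexGaussian hv).map_eq,
    integral_map (MeasurableEquiv.measurable _).aemeasurable (by fun_prop)] at h
  simpa using h

theorem memLp_re_conj_mul_complexGaussian {v : ℝ} (hv : 0 < v) {p : ENNReal} (hp : p ≠ ⊤) (d : ℂ) :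
    MemLp (fun z : ℂ => (star z * d).re) p (complexGaussian v) := by
  have h := ((memLp_re_complexGaussian hv hp).const_mul d.re).add
    ((memLp_im_complexGaussian hv hp).const_mul d.im)
  refine h.congr_norm (by fun_prop) (ae_of_all _ fun z => ?_)
  congr 1
  simp [Complex.mul_re]
  ring

theorem integral_re_conj_mul_complexGaussian {v : ℝ} (hv : 0 < v) (d : ℂ) :
    ∫ z : ℂ, (star z * d).re ∂complexGaussian v = 0 := by
  have := isProbabilityMeasure_complexGaussian hv
  have h : ∀ z : ℂ, (star z * d).re = d.re * z.re + d.im * z.im := fun z => by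
    simp [Complex.mul_re]; ring
  simp_rw [h]
  rw [integral_add (((memLp_re_complexGaussian hv ENNReal.one_ne_top).integrable le_rfl).const_mul _)
    (((memLp_im_complexGaussian hv ENNReal.one_ne_top).integrable le_rfl).const_mul _), integral_const_mul,
    integral_const_mul, integral_re_complexGaussian hv, integral_im_complexGaussian hv]
  simp

/-- The squares of both parts have mean `v/2` and the mixed term has mean zero, so the real inner
product of `d` and `e` survives. This is the source of the factor 2 in the bound. -/
theorem integral_re_conj_mul_mul_complexGaussian {v : ℝ} (hv : 0 < v) (d e : ℂ) :
    ∫ z : ℂ, (star z * d).re * (star z * e).re ∂complexGaussian v = v / 2 * (star d * e).re := by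
  have h : ∀ z : ℂ, (star z * d).re * (star z * e).re = d.re * e.re * z.re ^ 2 +
      d.im * e.im * z.im ^ 2 + (d.re * e.im + d.im * e.re) * (z.re * z.im) := fun z => by
    simp [Complex.mul_re]; ring
  have hr := memLp_re_complexGaussian hv ENNReal.ofNat_ne_top (p := 2)
  have hi := memLp_im_complexGaussian hv ENNReal.ofNat_ne_top (p := 2)
  simp_rw [h]
  have hri : Integrable (fun z : ℂ => z.re * z.im) (complexGaussian v) := hr.integrable_mul hi
  have hadd : Integrable (fun z : ℂ => d.re * e.re * z.re ^ 2 + d.im * e.im * z.im ^ 2)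
      (complexGaussian v) := (hr.integrable_sq.const_mul _).add (hi.integrable_sq.const_mul _)
  rw [integral_add hadd (hri.const_mul _),
    integral_add (hr.integrable_sq.const_mul _) (hi.integrable_sq.const_mul _),
    integral_const_mul, integral_const_mul, integral_const_mul,
    integral_re_sq_complexGaussian hv, integral_im_sq_complexGaussian hv,
    integral_re_mul_im_complexGaussian hv]
  simp [Complex.mul_re]
  ring

theorem integrable_complexGaussian_density {v : ℝ} (hv : 0 < v) :
    Integrable (fun z : ℂ => (Real.pi * v)⁻¹ * Real.exp (-(‖z‖ ^ 2 / v))) := by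
  have := isProbabilityMeasure_complexGaussian hv
  refine ⟨by fun_prop, ?_⟩
  rw [hasFiniteIntegral_iff_ofReal (ae_of_all _ fun z => by positivity)]
  have h := measure_univ (μ := complexGaussian v)
  rw [complexGaussian, withDensity_apply _ .univ, Measure.restrict_univ] at h
  rw [h]
  exact ENNReal.one_lt_top

theorem pi_complexGaussian {ι : Type*} [Fintype ι] {v : ℝ} (hv : 0 < v) :
    (Measure.pi fun _ : ι => complexGaussian v) = volume.withDensity fun z : ι → ℂ =>
      ENNReal.ofReal ((Real.pi * v)⁻¹ ^ Fintype.card ι * Real.exp (-((∑ i, ‖z i‖ ^ 2) / v))) := by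
  unfold complexGaussian
  rw [pi_withDensity_ofReal _ (fun _ => integrable_complexGaussian_density hv)
    fun _ _ => by positivity]
  rw [volume_pi]
  congr 1
  ext z
  rw [Finset.prod_mul_distrib, Finset.prod_const, ← Real.exp_sum, Finset.card_univ,
    Finset.sum_neg_distrib, Finset.sum_div]

theorem sum_norm_sq_mulVec_of_unitary {ι : Type*} [Fintype ι] [DecidableEq ι]
    {U : Matrix ι ι ℂ} (hU : Uᴴ * U = 1) (z : ι → ℂ) :
    ∑ i, ‖(U *ᵥ z) i‖ ^ 2 = ∑ i, ‖z i‖ ^ 2 := by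
  have h : ∀ w : ι → ℂ, ((∑ i, ‖w i‖ ^ 2 : ℝ) : ℂ) = star w ⬝ᵥ w := fun w => by
    simp [dotProduct, ← Complex.normSq_eq_conj_mul_self, Complex.normSq_eq_norm_sq]
  apply Complex.ofReal_injective
  rw [h, h, Matrix.star_mulVec, Matrix.dotProduct_mulVec, Matrix.vecMul_vecMul, hU,
    Matrix.vecMul_one]

/-- The law of a vector of independent circular Gaussian variables of equal variance is
invariant under unitary matrices. -/
theorem map_mulVec_pi_complexGaussian {ι : Type*} [Fintype ι] [DecidableEq ι]
    {U : Matrix ι ι ℂ} (hU : Uᴴ * U = 1) {v : ℝ} (hv : 0 < v) :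
    (Measure.pi fun _ : ι => complexGaussian v).map (fun z => U *ᵥ z) =
      Measure.pi fun _ : ι => complexGaussian v := by
  have := isProbabilityMeasure_complexGaussian hv
  set Q := Measure.pi fun _ : ι => complexGaussian v with hQ
  have hm : Measurable fun z : ι → ℂ => U *ᵥ z := (by fun_prop : Continuous _).measurable
  let f : (ι → ℂ) →ₗ[ℝ] (ι → ℂ) := (Matrix.toLin' U).restrictScalars ℝ
  let f' : (ι → ℂ) →ₗ[ℝ] (ι → ℂ) := (Matrix.toLin' Uᴴ).restrictScalars ℝ
  have hff : f' ∘ₗ f = LinearMap.id := by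
    refine LinearMap.ext fun z => ?_
    simp [f, f', hU]
  have hdet : LinearMap.det f ≠ 0 := by
    intro h0
    have := congrArg LinearMap.det hff
    rw [LinearMap.det_comp, h0, mul_zero, LinearMap.det_id] at this
    exact zero_ne_one this
  have hvol := Measure.map_linearMap_addHaar_eq_smul_addHaar (volume : Measure (ι → ℂ)) hdet
  have hfm : (f : (ι → ℂ) → ι → ℂ) = fun z => U *ᵥ z := by ext1 z; simp [f]
  rw [hfm] at hvol
  -- The density depends on the norm only, so `U` can change the law merely by the constant Jacobian
  -- factor of Lebesgue measure. That factor need not be computed: both sides have total mass one.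
  obtain ⟨k, hk⟩ : ∃ k : ENNReal, Q.map (fun z => U *ᵥ z) = k • Q := by
    refine ⟨ENNReal.ofReal |(LinearMap.det f)⁻¹|, ?_⟩
    rw [hQ, pi_complexGaussian hv, ← withDensity_smul_measure, ← hvol,
      ← map_withDensity_comp _ hm (by fun_prop)]
    simp_rw [sum_norm_sq_mulVec_of_unitary hU]
  have h1 := congrArg (fun m : Measure (ι → ℂ) => m Set.univ) hk
  simp only [Measure.map_apply hm .univ, Set.preimage_univ, measure_univ, Measure.smul_apply,
    smul_eq_mul, mul_one] at h1
  rw [hk, ← h1, one_smul]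

/-- Distinct coordinates of an i.i.d. family are again i.i.d.; this handles the selection of `P` out
of `L` Fourier rows. -/
theorem map_comp_pi {ι κ E : Type*} [Fintype ι] [Fintype κ] [MeasurableSpace E]
    (μ : Measure E) [IsProbabilityMeasure μ] {g : κ → ι} (hg : g.Injective) :
    (Measure.pi fun _ : ι => μ).map (fun z j => z (g j)) = Measure.pi fun _ : κ => μ := by
  have h := (iIndepFun_pi (μ := fun _ : ι => μ) (X := fun _ x => x)
    fun _ => aemeasurable_id).precomp hg
  rw [iIndepFun_iff_map_fun_eq_pi_map fun i => (measurable_pi_apply _).aemeasurable] at h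
  refine h.trans ?_
  congr 1
  ext1 j
  exact (measurePreserving_eval (fun _ : ι => μ) (g j)).map_eq

end gaussian

/-! ### The data law -/

section dataLaw

variable {K L M P N : ℕ}

/-- With `c = id` all `L` cosets are kept and the matrix is the full Fourier matrix. Each entry of
the Gram matrix is a normalised geometric sum in the `L`-th root of unity `ω`. -/
theorem samplingMatrix_id_conjTranspose_mul_self :
    (samplingMatrix (id : Fin L → Fin L))ᴴ * samplingMatrix (id : Fin L → Fin L) = 1 := by
  ext l l'
  have hL : (L : ℂ) ≠ 0 := Nat.cast_ne_zero.2 (Fin.pos l).ne'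
  have hsq : ((Real.sqrt L : ℝ) : ℂ)⁻¹ * ((Real.sqrt L : ℝ) : ℂ)⁻¹ = (L : ℂ)⁻¹ := by
    rw [← mul_inv, ← Complex.ofReal_mul, Real.mul_self_sqrt (Nat.cast_nonneg _)]
    simp
  set ω := Complex.exp (2 * Real.pi * Complex.I * ((((l' : ℕ) : ℤ) - ((l : ℕ) : ℤ) : ℤ) : ℂ) / L)
    with hω
  have hterm : ∀ i : Fin L, star (samplingMatrix (id : Fin L → Fin L) i l) *
      samplingMatrix (id : Fin L → Fin L) i l' = (L : ℂ)⁻¹ * ω ^ (i : ℕ) := by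
    intro i
    simp only [samplingMatrix, Matrix.of_apply, id, star_mul', RCLike.star_def, map_inv₀,
      Complex.conj_ofReal, ← Complex.exp_conj]
    rw [mul_mul_mul_comm, hsq, ← Complex.exp_add, hω, ← Complex.exp_nat_mul]
    congr 2
    simp only [map_mul, map_add, map_div₀, Complex.conj_I, Complex.conj_ofReal, Complex.conj_natCast,
      map_ofNat, map_one]
    push_cast
    ring
  rw [Matrix.mul_apply]
  simp_rw [Matrix.conjTranspose_apply, hterm]
  rw [← Finset.mul_sum, Fin.sum_univ_eq_sum_range (fun i => ω ^ i), Matrix.one_apply]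
  split_ifs with h
  · subst h
    simp [hω, hL]
  -- `ω = 1` would make `L` divide `l' - l`, whose absolute value is below `L`.
  · have hω1 : ω ≠ 1 := by
      rw [hω, Ne, Complex.exp_eq_one_iff]
      rintro ⟨n, hn⟩
      have hpi : (2 * Real.pi * Complex.I : ℂ) ≠ 0 := Complex.two_pi_I_ne_zero
      have h2 : ((((l' : ℕ) : ℤ) - ((l : ℕ) : ℤ) : ℤ) : ℂ) = ((n * L : ℤ) : ℂ) := by
        field_simp at hn
        push_cast at hn ⊢
        rw [hn, mul_comm]
      have h3 := Int.cast_injective h2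
      have hl := l.isLt
      have hl' := l'.isLt
      have hn0 : n = 0 := by
        by_contra hn0
        have : (L : ℤ) ≤ |n * L| := by
          rw [abs_mul, Nat.abs_cast]
          have := Int.one_le_abs hn0
          nlinarith
        rw [← h3] at this
        rcases abs_cases (((l' : ℕ) : ℤ) - ((l : ℕ) : ℤ)) with ⟨h, _⟩ | ⟨h, _⟩ <;> omega
      subst hn0
      exact h (Fin.ext (by omega))
    have hωL : ω ^ L = 1 := by
      rw [hω, ← Complex.exp_nat_mul, mul_div_cancel₀ _ hL, mul_comm]
      exact Complex.exp_int_mul_two_pi_mul_I _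
    rw [geom_sum_eq hω1, hωL]
    simp

theorem noiseMatrix_id_conjTranspose_mul_self (M : ℕ) :
    (noiseMatrix M (id : Fin L → Fin L))ᴴ * noiseMatrix M (id : Fin L → Fin L) = 1 := by
  rw [noiseMatrix, Matrix.conjTranspose_kronecker, ← Matrix.mul_kronecker_mul,
    samplingMatrix_id_conjTranspose_mul_self]
  simp

/-- The received noise is again white, because the rows of the sampling matrix are distinct rows
of the unitary Fourier matrix. -/
theorem map_noiseMatrix_mulVec {c : Fin P → Fin L} (hc : c.Injective) {v : ℝ} (hv : 0 < v) :
    (Measure.pi fun _ : Fin M × Fin L => complexGaussian v).map (fun n => noiseMatrix M c *ᵥ n) =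
      Measure.pi fun _ : Fin M × Fin P => complexGaussian v := by
  have := isProbabilityMeasure_complexGaussian hv
  have hg : (Prod.map id c : Fin M × Fin P → Fin M × Fin L).Injective :=
    Function.injective_id.prodMap hc
  rw [← map_comp_pi (complexGaussian v) hg]
  -- White noise on all `M L` channels is replaced by its unitary image. Selecting the rows `(m, c
  -- i)` of that image is multiplication by `noiseMatrix M c`, by definition.
  conv_rhs => rw [← map_mulVec_pi_complexGaussian (noiseMatrix_id_conjTranspose_mul_self M) hv]
  rw [Measure.map_map (by fun_prop) (by fun_prop : Continuous _).measurable]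
  rfl

theorem observationLaw_eq_map (a : ℝ → Fin M → ℂ) {c : Fin P → Fin L} (hc : c.Injective)
    (Ω : Fin K → Fin L) {v : ℝ} (hv : 0 < v) (φ : Fin K → ℝ) (s : Fin N → Fin K → ℂ) :
    observationLaw a c Ω v φ s =
      (Measure.pi fun _ : Fin N => Measure.pi fun _ : Fin M × Fin P => complexGaussian v).map
        fun z f => unionMatrix a c Ω φ *ᵥ s f + z f := by
  have := isProbabilityMeasure_complexGaussian hv
  have hm : Measurable fun n : Fin M × Fin L → ℂ => noiseMatrix M c *ᵥ n :=
    (by fun_prop : Continuous _).measurable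
  have : IsProbabilityMeasure ((Measure.pi fun _ : Fin M × Fin L => complexGaussian v).map
      (fun n => noiseMatrix M c *ᵥ n)) := Measure.isProbabilityMeasure_map hm.aemeasurable
  have h := Measure.pi_map_pi (ι := Fin N)
    (μ := fun _ => Measure.pi fun _ : Fin M × Fin L => complexGaussian v)
    (f := fun _ n => noiseMatrix M c *ᵥ n) fun _ => hm.aemeasurable
  simp only [map_noiseMatrix_mulVec hc hv] at h
  rw [← h, Measure.map_map (by fun_prop) (by fun_prop : Continuous _).measurable]
  rfl

theorem pi_pi_complexGaussian {ι κ : Type*} [Fintype ι] [Fintype κ] {v : ℝ} (hv : 0 < v) :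
    (Measure.pi fun _ : ι => Measure.pi fun _ : κ => complexGaussian v) =
      volume.withDensity fun z : ι → κ → ℂ => ENNReal.ofReal
        (((Real.pi * v)⁻¹ ^ Fintype.card κ) ^ Fintype.card ι *
          Real.exp (-((∑ f, ∑ i, ‖z f i‖ ^ 2) / v))) := by
  have hp := isProbabilityMeasure_complexGaussian hv
  have hint : Integrable fun z : κ → ℂ =>
      (Real.pi * v)⁻¹ ^ Fintype.card κ * Real.exp (-((∑ i, ‖z i‖ ^ 2) / v)) := by
    refine ⟨(by fun_prop : Continuous _).aestronglyMeasurable, ?_⟩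
    rw [hasFiniteIntegral_iff_ofReal (ae_of_all _ fun z => by positivity)]
    have h := measure_univ (μ := Measure.pi fun _ : κ => complexGaussian v)
    rw [pi_complexGaussian hv, withDensity_apply _ .univ, Measure.restrict_univ] at h
    rw [h]
    exact ENNReal.one_lt_top
  simp_rw [pi_complexGaussian hv]
  rw [pi_withDensity_ofReal _ (fun _ => hint) fun _ _ => by positivity, volume_pi]
  congr 1
  ext z
  rw [Finset.prod_mul_distrib, Finset.prod_const, ← Real.exp_sum, Finset.card_univ,
    Finset.sum_neg_distrib, Finset.sum_div]

theorem observationLaw_eq_withDensity (a : ℝ → Fin M → ℂ) {c : Fin P → Fin L} (hc : c.Injective)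
    (Ω : Fin K → Fin L) {v : ℝ} (hv : 0 < v) (φ : Fin K → ℝ) (s : Fin N → Fin K → ℂ) :
    observationLaw a c Ω v φ s = volume.withDensity fun y =>
      ENNReal.ofReal (Real.exp (logLikelihood a c Ω v φ s y)) := by
  set m : Fin N → Fin M × Fin P → ℂ := fun f => unionMatrix a c Ω φ *ᵥ s f with hmdef
  have hlog : Measurable fun y : Fin N → Fin M × Fin P → ℂ =>
      ENNReal.ofReal (Real.exp (logLikelihood a c Ω v φ s y)) := by
    unfold logLikelihood
    fun_prop
  rw [observationLaw_eq_map a hc Ω hv, pi_pi_complexGaussian hv]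
  -- Translation by the noise-free data preserves Lebesgue measure, so the density of the data is
  -- the noise density at the residual.
  have hvol : (volume : Measure (Fin N → Fin M × Fin P → ℂ)).map (fun z => m + z) = volume :=
    (measurePreserving_add_left volume m).map_eq
  conv_rhs => rw [← hvol]
  rw [← map_withDensity_comp _ (by fun_prop) hlog]
  congr 2
  ext z
  congr 1
  have h0 : 0 < Real.pi * v := by positivity
  rw [logLikelihood, sub_eq_add_neg, Real.exp_add]
  congr 1
  · rw [← pow_mul, inv_pow, ← Real.exp_log (pow_pos h0 _), ← Real.exp_neg, Real.log_pow]
    congr 1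
    rw [Fintype.card_prod, Fintype.card_fin, Fintype.card_fin, Fintype.card_fin]
    push_cast
    ring
  · congr 2
    rw [div_eq_inv_mul]
    simp [hmdef]

end dataLaw

/-! ### Real forms of complex matrices and the Schur complement -/

section realForm

variable {m n p k : Type*}

/-- The real matrix of a complex matrix acting on real and imaginary parts. -/
def realify (Z : Matrix m n ℂ) : Matrix (m ⊕ m) (n ⊕ n) ℝ :=
  Matrix.fromBlocks (Z.map Complex.re) (-(Z.map Complex.im)) (Z.map Complex.im) (Z.map Complex.re)

/-- The real parts of a complex matrix on top of its imaginary parts. -/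
def stackReIm (Z : Matrix m n ℂ) : Matrix (m ⊕ m) n ℝ :=
  Matrix.fromRows (Z.map Complex.re) (Z.map Complex.im)

theorem map_re_mul [Fintype n] (Z : Matrix m n ℂ) (W : Matrix n p ℂ) :
    (Z * W).map Complex.re =
      Z.map Complex.re * W.map Complex.re - Z.map Complex.im * W.map Complex.im := by
  ext i j
  simp [Matrix.mul_apply, Complex.mul_re, Finset.sum_sub_distrib]

theorem map_im_mul [Fintype n] (Z : Matrix m n ℂ) (W : Matrix n p ℂ) :
    (Z * W).map Complex.im =
      Z.map Complex.re * W.map Complex.im + Z.map Complex.im * W.map Complex.re := by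
  ext i j
  simp [Matrix.mul_apply, Complex.mul_im, Finset.sum_add_distrib]

theorem realify_mul [Fintype n] (Z : Matrix m n ℂ) (W : Matrix n p ℂ) :
    realify (Z * W) = realify Z * realify W := by
  simp only [realify, Matrix.fromBlocks_multiply, map_re_mul, map_im_mul]
  congr 1
  · simp [sub_eq_add_neg]
  · simp [add_comm]
  · simp [add_comm]
  · simp [sub_eq_add_neg, add_comm]

theorem realify_one [DecidableEq n] : realify (1 : Matrix n n ℂ) = 1 := by
  rw [realify, ← Matrix.fromBlocks_one]
  congr 1 <;> (ext i j; by_cases h : i = j <;> simp [Matrix.one_apply, h])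

theorem realify_conjTranspose (Z : Matrix m n ℂ) : realify Zᴴ = (realify Z)ᵀ := by
  rw [realify, realify, Matrix.fromBlocks_transpose]
  congr 1
  ext i j
  simp

theorem realify_mul_stackReIm [Fintype n] (Z : Matrix m n ℂ) (W : Matrix n p ℂ) :
    realify Z * stackReIm W = stackReIm (Z * W) := by
  simp only [realify, stackReIm, Matrix.fromBlocks_mul_fromRows, map_re_mul, map_im_mul]
  congr 1
  · simp [sub_eq_add_neg]
  · simp [add_comm]

theorem stackReIm_transpose_mul [Fintype m] (Z : Matrix m n ℂ) (W : Matrix m p ℂ) :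
    (stackReIm Z)ᵀ * stackReIm W = (Zᴴ * W).map Complex.re := by
  rw [stackReIm, stackReIm, Matrix.transpose_fromRows, Matrix.fromCols_mul_fromRows, map_re_mul]
  ext i j
  simp [Matrix.mul_apply]

/-- A complex amplitude is two real parameters with derivative columns `W` and `iW`. Their real
stacking is the real form of `W`, which lets complex algebra do the elimination. -/
theorem stackReIm_fromCols (Z : Matrix m k ℂ) (W : Matrix m n ℂ) :
    stackReIm (Matrix.fromCols Z (Matrix.fromCols W (Complex.I • W))) =
      Matrix.fromCols (stackReIm Z) (realify W) := by
  ext (i | i) (j | j | j) <;> simp [stackReIm, realify]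

variable [Fintype m] [DecidableEq m] [Fintype n] [DecidableEq n] [Fintype k] [DecidableEq k]

/-- Elimination of complex nuisance amplitudes: for the real Gram matrix of the columns of `Z`,
`W` and `I • W`, the block of the inverse that belongs to `Z` is the inverse of the real Gram
matrix of the projections of the columns of `Z` onto the orthogonal complement of the range of
`W`. -/
theorem inv_realGram_submatrix (Z : Matrix m k ℂ) (W : Matrix m n ℂ)
    (hW : IsUnit (Wᴴ * W).det) (hS : IsUnit ((Zᴴ * orthProj W * Z).map Complex.re).det) :
    let J := Matrix.fromCols Z (Matrix.fromCols W (Complex.I • W))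
    IsUnit ((Jᴴ * J).map Complex.re).det ∧
      (((Jᴴ * J).map Complex.re)⁻¹).submatrix Sum.inl Sum.inl =
        ((Zᴴ * orthProj W * Z).map Complex.re)⁻¹ := by
  intro J
  set D := realify (Wᴴ * W) with hD
  set C := stackReIm (Wᴴ * Z) with hC
  have hF : (Jᴴ * J).map Complex.re =
      Matrix.fromBlocks ((Zᴴ * Z).map Complex.re) Cᵀ C D := by
    rw [← stackReIm_transpose_mul, stackReIm_fromCols, Matrix.transpose_fromCols,
      Matrix.fromRows_mul_fromCols, stackReIm_transpose_mul, hC, hD, realify_mul,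
      ← realify_mul_stackReIm, realify_conjTranspose, Matrix.transpose_mul,
      Matrix.transpose_transpose]
  -- `realify` is multiplicative and unital, so the real nuisance block is inverted by the real form
  -- of the complex inverse.
  let iD : Invertible D := ⟨realify (Wᴴ * W)⁻¹,
    by rw [hD, ← realify_mul, Matrix.nonsing_inv_mul _ hW, realify_one],
    by rw [hD, ← realify_mul, Matrix.mul_nonsing_inv _ hW, realify_one]⟩
  -- The real Schur complement is the real part of the complex expression `ZᴴZ - ZᴴW(WᴴW)⁻¹WᴴZ`.
  have hSchur : (Zᴴ * Z).map Complex.re - Cᵀ * ⅟D * C =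
      (Zᴴ * orthProj W * Z).map Complex.re := by
    have hi : ⅟D = realify (Wᴴ * W)⁻¹ := rfl
    have hZ : Zᴴ * orthProj W * Z = Zᴴ * Z - (Wᴴ * Z)ᴴ * ((Wᴴ * W)⁻¹ * (Wᴴ * Z)) := by
      simp only [orthProj, Matrix.mul_sub, Matrix.sub_mul, Matrix.mul_one,
        Matrix.conjTranspose_mul, Matrix.conjTranspose_conjTranspose, Matrix.mul_assoc]
    rw [hi, Matrix.mul_assoc, hC, realify_mul_stackReIm, stackReIm_transpose_mul, hZ]
    ext i j
    simp
  let iS : Invertible ((Zᴴ * Z).map Complex.re - Cᵀ * ⅟D * C) :=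
    Matrix.invertibleOfIsUnitDet _ (hSchur ▸ hS)
  let iF : Invertible (Matrix.fromBlocks ((Zᴴ * Z).map Complex.re) Cᵀ C D) :=
    Matrix.fromBlocks₂₂Invertible _ _ _ _
  rw [hF]
  refine ⟨Matrix.isUnit_det_of_invertible _, ?_⟩
  rw [← Matrix.invOf_eq_nonsing_inv, Matrix.invOf_fromBlocks₂₂_eq, ← hSchur,
    ← Matrix.invOf_eq_nonsing_inv]
  ext i j
  rfl

end realForm

/-! ### Jacobian of the noise-free data -/

section jacobian

variable {K L M P N : ℕ}

/-- Derivatives of the noise-free data `G_S s(f)` in the spatial phases. -/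
def phaseJacobian (a : ℝ → Fin M → ℂ) (c : Fin P → Fin L) (Ω : Fin K → Fin L)
    (φ : Fin K → ℝ) (s : Fin N → Fin K → ℂ) : Matrix (Fin N × Fin M × Fin P) (Fin K) ℂ :=
  Matrix.of fun x k => s x.1 k * unionDerivMatrix a c Ω φ x.2 k

/-- Derivatives of the noise-free data `G_S s(f)` in the real parts of the signals. -/
def signalJacobian (N : ℕ) (a : ℝ → Fin M → ℂ) (c : Fin P → Fin L) (Ω : Fin K → Fin L)
    (φ : Fin K → ℝ) : Matrix (Fin N × Fin M × Fin P) (Fin N × Fin K) ℂ :=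
  (1 : Matrix (Fin N) (Fin N) ℂ) ⊗ₖ unionMatrix a c Ω φ

/-- Derivatives of the noise-free data in all parameters. -/
def meanJacobian (a : ℝ → Fin M → ℂ) (c : Fin P → Fin L) (Ω : Fin K → Fin L)
    (φ : Fin K → ℝ) (s : Fin N → Fin K → ℂ) :
    Matrix (Fin N × Fin M × Fin P) (ParamIdx K N) ℂ :=
  Matrix.fromCols (phaseJacobian a c Ω φ s)
    (Matrix.fromCols (signalJacobian N a c Ω φ) (Complex.I • signalJacobian N a c Ω φ))

/-- Each snapshot has its own amplitudes, so the nuisance space splits over snapshots and the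
projection acts on each one separately. -/
theorem orthProj_one_kronecker {ι m k : Type*} [Fintype ι] [DecidableEq ι] [Fintype m]
    [DecidableEq m] [Fintype k] [DecidableEq k] (G : Matrix m k ℂ) :
    orthProj ((1 : Matrix ι ι ℂ) ⊗ₖ G) = (1 : Matrix ι ι ℂ) ⊗ₖ orthProj G := by
  rw [orthProj, orthProj, Matrix.conjTranspose_kronecker, Matrix.conjTranspose_one,
    ← Matrix.mul_kronecker_mul, Matrix.mul_one, Matrix.inv_kronecker, inv_one,
    ← Matrix.mul_kronecker_mul, ← Matrix.mul_kronecker_mul, Matrix.mul_one, Matrix.mul_one,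
    ← Matrix.one_kronecker_one, sub_eq_iff_eq_add, ← Matrix.kronecker_add, sub_add_cancel]

theorem isUnit_det_signalJacobian_gram (N : ℕ) (a : ℝ → Fin M → ℂ) (c : Fin P → Fin L)
    (Ω : Fin K → Fin L) (φ : Fin K → ℝ)
    (hG : IsUnit ((unionMatrix a c Ω φ)ᴴ * unionMatrix a c Ω φ).det) :
    IsUnit ((signalJacobian N a c Ω φ)ᴴ * signalJacobian N a c Ω φ).det := by
  rw [signalJacobian, Matrix.conjTranspose_kronecker, ← Matrix.mul_kronecker_mul,
    Matrix.det_kronecker]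
  simp only [Matrix.conjTranspose_one, Matrix.det_one, one_pow, one_mul]
  exact hG.pow _

/-- Column `k` of the Jacobian carries the scalar `s f k` in snapshot `f`. The `(k, k')` entry thus
collects `conj (s f k) * s f k'`, which is `N` times the `(k', k)` entry of the autocorrelation:
hence the transpose. -/
theorem phaseJacobian_schur (a : ℝ → Fin M → ℂ) (c : Fin P → Fin L) (Ω : Fin K → Fin L)
    (φ : Fin K → ℝ) (s : Fin N → Fin K → ℂ) (hN : N ≠ 0) :
    ((phaseJacobian a c Ω φ s)ᴴ * orthProj (signalJacobian N a c Ω φ) *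
      phaseJacobian a c Ω φ s).map Complex.re =
      (N : ℝ) • infoMatrix a c Ω φ (subAutocorrelation s)ᵀ := by
  set E := unionDerivMatrix a c Ω φ with hE
  set Q := orthProj (unionMatrix a c Ω φ) with hQ
  have h1 : ∀ f i k, (((1 : Matrix (Fin N) (Fin N) ℂ) ⊗ₖ Q) * phaseJacobian a c Ω φ s) (f, i) k =
      s f k * (Q * E) i k := by
    intro f i k
    rw [Matrix.mul_apply, Fintype.sum_prod_type, Finset.sum_eq_single f]
    · simp [phaseJacobian, Matrix.mul_apply, ← hE, Finset.mul_sum, mul_left_comm]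
    · intro f' _ hf
      simp [Matrix.one_apply_ne hf.symm]
    · simp
  have h2 : (phaseJacobian a c Ω φ s)ᴴ * orthProj (signalJacobian N a c Ω φ) *
      phaseJacobian a c Ω φ s =
      (N : ℂ) • ((Eᴴ * Q * E) ⊙ (subAutocorrelation s)ᵀ) := by
    ext k k'
    have hN' : (N : ℂ) ≠ 0 := Nat.cast_ne_zero.2 hN
    rw [signalJacobian, orthProj_one_kronecker, Matrix.mul_assoc, Matrix.mul_apply,
      Fintype.sum_prod_type]
    simp only [← hQ, h1]
    have h3 : (subAutocorrelation s)ᵀ k k' = (N : ℂ)⁻¹ * ∑ f, s f k' * star (s f k) := by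
      simp [subAutocorrelation, Matrix.sum_apply, Matrix.vecMulVec_apply]
    rw [Matrix.smul_apply, Matrix.hadamard_apply, h3, Matrix.mul_assoc, Matrix.mul_apply,
      smul_eq_mul, mul_left_comm, mul_inv_cancel_left₀ hN', Finset.sum_mul_sum, Finset.sum_comm]
    refine Finset.sum_congr rfl fun f _ => Finset.sum_congr rfl fun i _ => ?_
    simp only [phaseJacobian, Matrix.conjTranspose_apply, Matrix.of_apply, star_mul', ← hE]
    ring
  rw [h2, infoMatrix, ← hE, ← hQ]
  ext k k'
  simp

end jacobian

/-! ### Sums of independent variables -/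

section independentSums

open ProbabilityTheory

variable {ι E : Type*} [Fintype ι] [MeasurableSpace E] {μ : Measure E} [IsProbabilityMeasure μ]

theorem memLp_sum_comp_eval {g : ι → E → ℝ} {p : ENNReal} (hg : ∀ i, MemLp (g i) p μ) :
    MemLp (fun x : ι → E => ∑ i, g i (x i)) p (Measure.pi fun _ : ι => μ) :=
  memLp_finsetSum _ fun i _ =>
    (hg i).comp_measurePreserving (measurePreserving_eval (fun _ : ι => μ) i)

theorem integral_sum_comp_eval_eq_zero {g : ι → E → ℝ} (hg : ∀ i, Integrable (g i) μ)
    (hg0 : ∀ i, ∫ x, g i x ∂μ = 0) :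
    ∫ x : ι → E, ∑ i, g i (x i) ∂(Measure.pi fun _ : ι => μ) = 0 := by
  rw [integral_finsetSum _ fun i _ => integrable_comp_eval (μ := fun _ : ι => μ) (hg i)]
  refine Finset.sum_eq_zero fun i _ => ?_
  rw [integral_comp_eval (μ := fun _ : ι => μ) (hg i).1, hg0]

/-- Off-diagonal products factor by independence, and a zero mean of one factor suffices to kill
them. -/
theorem integral_sum_mul_sum_comp_eval {g h : ι → E → ℝ} (hg : ∀ i, MemLp (g i) 2 μ)
    (hh : ∀ i, MemLp (h i) 2 μ) (hg0 : ∀ i, ∫ x, g i x ∂μ = 0) :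
    ∫ x : ι → E, (∑ i, g i (x i)) * ∑ i, h i (x i) ∂(Measure.pi fun _ : ι => μ) =
      ∑ i, ∫ x, g i x * h i x ∂μ := by
  have hg' := fun i => (hg i).comp_measurePreserving (measurePreserving_eval (fun _ : ι => μ) i)
  have hh' := fun i => (hh i).comp_measurePreserving (measurePreserving_eval (fun _ : ι => μ) i)
  have hint : ∀ i j, Integrable (fun x : ι → E => g i (x i) * h j (x j))
      (Measure.pi fun _ : ι => μ) := fun i j => (hg' i).integrable_mul (hh' j)
  simp_rw [Finset.sum_mul_sum]
  rw [integral_finsetSum _ fun i _ => integrable_finsetSum _ fun j _ => hint i j]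
  refine Finset.sum_congr rfl fun i _ => ?_
  rw [integral_finsetSum _ fun j _ => hint i j, Finset.sum_eq_single i]
  · exact integral_comp_eval (μ := fun _ : ι => μ) (f := fun x => g i x * h i x)
      ((hg i).integrable_mul (hh i)).1
  · intro j _ hj
    have hind := (iIndepFun_pi (μ := fun _ : ι => μ) (X := fun _ x => x)
      fun _ => aemeasurable_id).indepFun hj.symm
    rw [hind.integral_fun_comp_mul_comp (measurable_pi_apply i).aemeasurable
      (measurable_pi_apply j).aemeasurable, integral_comp_eval (μ := fun _ : ι => μ) (hg i).1,
      hg0, zero_mul]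
    · rw [(measurePreserving_eval (fun _ : ι => μ) i).map_eq]
      exact (hg i).1
    · rw [(measurePreserving_eval (fun _ : ι => μ) j).map_eq]
      exact (hh j).1
  · simp

end independentSums

/-! ### White noise -/

section whiteNoise

/-- The law of an array of independent circular Gaussian variables of variance `v`. -/
abbrev whiteNoise (ι κ : Type*) [Fintype ι] [Fintype κ] (v : ℝ) : Measure (ι → κ → ℂ) :=
  Measure.pi fun _ : ι => Measure.pi fun _ : κ => complexGaussian v

/-- The real inner product of two complex arrays. -/
def realInner {ι κ : Type*} [Fintype ι] [Fintype κ] (z : ι → κ → ℂ) (d : ι × κ → ℂ) : ℝ :=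
  ∑ f, ∑ i, (star (z f i) * d (f, i)).re

/-- The squared Euclidean norm of a complex array. -/
def sqNorm {ι κ : Type*} [Fintype ι] [Fintype κ] (z : ι → κ → ℂ) : ℝ :=
  ∑ f, ∑ i, ‖z f i‖ ^ 2

variable {ι κ : Type*} [Fintype ι] [Fintype κ] {v : ℝ}

theorem continuous_realInner (d : ι × κ → ℂ) : Continuous fun z : ι → κ → ℂ => realInner z d := by
  unfold realInner
  fun_prop

theorem continuous_sqNorm : Continuous (sqNorm : (ι → κ → ℂ) → ℝ) := by
  unfold sqNorm
  fun_prop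

theorem isProbabilityMeasure_whiteNoise (hv : 0 < v) :
    IsProbabilityMeasure (whiteNoise ι κ v) := by
  have := isProbabilityMeasure_complexGaussian hv
  infer_instance

/-- Symmetry of the noise, which makes integrals of odd functions vanish. -/
theorem isNegInvariant_whiteNoise (hv : 0 < v) : (whiteNoise ι κ v).IsNegInvariant := by
  refine ⟨?_⟩
  have hvol : (volume : Measure (ι → κ → ℂ)).map (fun z => -z) = volume :=
    (volume_preserving_pi fun _ : ι => volume_preserving_pi fun _ : κ =>
      Measure.measurePreserving_neg (volume : Measure ℂ)).map_eq
  rw [Measure.neg, whiteNoise, pi_pi_complexGaussian hv]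
  conv_rhs => rw [← hvol]
  rw [← map_withDensity_comp _ measurable_neg
    (by fun_prop : Continuous _).measurable.ennreal_ofReal]
  simp only [Pi.neg_apply, norm_neg]

theorem isOpenPosMeasure_complexGaussian (hv : 0 < v) : (complexGaussian v).IsOpenPosMeasure := by
  have h : (volume : Measure ℂ) ≪ complexGaussian v :=
    withDensity_absolutelyContinuous' (by fun_prop) (ae_of_all _ fun z => by
      simp only [ne_eq, ENNReal.ofReal_eq_zero, not_le]
      positivity)
  exact h.isOpenPosMeasure

theorem isOpenPosMeasure_whiteNoise (hv : 0 < v) : (whiteNoise ι κ v).IsOpenPosMeasure := by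
  have := isProbabilityMeasure_complexGaussian hv
  have := isOpenPosMeasure_complexGaussian hv
  infer_instance

theorem memLp_realInner_whiteNoise (hv : 0 < v) (d : ι × κ → ℂ) :
    MemLp (fun z => realInner z d) 2 (whiteNoise ι κ v) := by
  have := isProbabilityMeasure_complexGaussian hv
  exact memLp_sum_comp_eval (g := fun f (z : κ → ℂ) => ∑ i, (star (z i) * d (f, i)).re) fun f =>
    memLp_sum_comp_eval (g := fun i (z : ℂ) => (star z * d (f, i)).re) fun i =>
      memLp_re_conj_mul_complexGaussian hv ENNReal.ofNat_ne_top _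

theorem integral_realInner_mul_realInner_whiteNoise (hv : 0 < v) (d e : ι × κ → ℂ) :
    ∫ z, realInner z d * realInner z e ∂whiteNoise ι κ v =
      v / 2 * (star d ⬝ᵥ e).re := by
  have := isProbabilityMeasure_complexGaussian hv
  have hL : ∀ d : ℂ, MemLp (fun z : ℂ => (star z * d).re) 2 (complexGaussian v) := fun d =>
    memLp_re_conj_mul_complexGaussian hv ENNReal.ofNat_ne_top d
  have h1 : ∀ (d : ι × κ → ℂ) f, MemLp (fun z : κ → ℂ => ∑ i, (star (z i) * d (f, i)).re) 2
      (Measure.pi fun _ : κ => complexGaussian v) := fun d f =>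
    memLp_sum_comp_eval (g := fun i (z : ℂ) => (star z * d (f, i)).re) fun i => hL _
  have h0 : ∀ f, ∫ z : κ → ℂ, ∑ i, (star (z i) * d (f, i)).re
      ∂(Measure.pi fun _ : κ => complexGaussian v) = 0 := fun f =>
    integral_sum_comp_eval_eq_zero (g := fun i (z : ℂ) => (star z * d (f, i)).re)
      (fun i => (hL _).integrable one_le_two)
      fun i => integral_re_conj_mul_complexGaussian hv _
  -- Independence is used twice: here across the first index, and in `h2` across the entries for a
  -- fixed first index.
  refine (integral_sum_mul_sum_comp_eval
    (g := fun f (z : κ → ℂ) => ∑ i, (star (z i) * d (f, i)).re)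
    (h := fun f (z : κ → ℂ) => ∑ i, (star (z i) * e (f, i)).re) (h1 d) (h1 e) h0).trans ?_
  have h2 : ∀ f, ∫ z : κ → ℂ, (∑ i, (star (z i) * d (f, i)).re) *
      (∑ i, (star (z i) * e (f, i)).re) ∂(Measure.pi fun _ : κ => complexGaussian v) =
      ∑ i, v / 2 * (star (d (f, i)) * e (f, i)).re := fun f => by
    refine (integral_sum_mul_sum_comp_eval (g := fun i (z : ℂ) => (star z * d (f, i)).re)
      (h := fun i (z : ℂ) => (star z * e (f, i)).re) (fun _ => hL _) (fun _ => hL _)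
      fun i => integral_re_conj_mul_complexGaussian hv _).trans ?_
    exact Finset.sum_congr rfl fun i _ => integral_re_conj_mul_mul_complexGaussian hv _ _
  simp_rw [h2, ← Finset.mul_sum]
  rw [dotProduct, Complex.re_sum, Fintype.sum_prod_type]
  rfl

/-- Finite fourth moments of both parts make the variance score square integrable. -/
theorem memLp_norm_sq_complexGaussian (hv : 0 < v) :
    MemLp (fun z : ℂ => ‖z‖ ^ 2) 2 (complexGaussian v) := by
  have hsq : ∀ {u : ℂ → ℝ}, Continuous u → MemLp u 4 (complexGaussian v) →
      MemLp (fun z => u z ^ 2) 2 (complexGaussian v) := fun {u} hu h => by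
    rw [memLp_two_iff_integrable_sq (by fun_prop)]
    have h4 := MemLp.integrable_norm_pow (p := 4) (by exact_mod_cast h) (by norm_num)
    refine h4.congr (ae_of_all _ fun z => ?_)
    simp only [Real.norm_eq_abs]
    rw [← pow_mul, (by decide : Even 4).pow_abs]
  have h := (hsq Complex.continuous_re (memLp_re_complexGaussian hv ENNReal.ofNat_ne_top)).add
    (hsq Complex.continuous_im (memLp_im_complexGaussian hv ENNReal.ofNat_ne_top))
  refine h.congr_norm (by fun_prop) (ae_of_all _ fun z => ?_)
  rw [Complex.sq_norm, Complex.normSq_apply]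
  simp [sq]

theorem memLp_sqNorm_whiteNoise (hv : 0 < v) : MemLp sqNorm 2 (whiteNoise ι κ v) := by
  have := isProbabilityMeasure_complexGaussian hv
  exact memLp_sum_comp_eval (g := fun (_ : ι) (z : κ → ℂ) => ∑ i, ‖z i‖ ^ 2) fun _ =>
    memLp_sum_comp_eval (g := fun (_ : κ) (z : ℂ) => ‖z‖ ^ 2) fun _ =>
      memLp_norm_sq_complexGaussian hv

/-- The integrand is odd. This decouples the noise variance from phases and signals. -/
theorem integral_realInner_mul_sqNorm_whiteNoise (hv : 0 < v) (d : ι × κ → ℂ) (α β : ℝ) :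
    ∫ z, realInner z d * (α + β * sqNorm z) ∂whiteNoise ι κ v = 0 := by
  have := isNegInvariant_whiteNoise (ι := ι) (κ := κ) hv
  have h := integral_neg_eq_self (fun z => realInner z d * (α + β * sqNorm z)) (whiteNoise ι κ v)
  have h1 : ∀ z : ι → κ → ℂ, realInner (-z) d = -realInner z d := fun z => by
    simp only [realInner, Pi.neg_apply, star_neg, neg_mul, Complex.neg_re,
      Finset.sum_neg_distrib]
  have h2 : ∀ z : ι → κ → ℂ, sqNorm (-z) = sqNorm z := fun z => by simp [sqNorm]
  simp_rw [h1, h2, neg_mul] at h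
  rw [integral_neg] at h
  linarith

theorem memLp_affine_sqNorm_whiteNoise (hv : 0 < v) (α β : ℝ) :
    MemLp (fun z => α + β * sqNorm z) 2 (whiteNoise ι κ v) := by
  have := isProbabilityMeasure_whiteNoise (ι := ι) (κ := κ) hv
  exact (memLp_const α).add ((memLp_sqNorm_whiteNoise hv).const_mul β)

/-- The integrand is continuous, nonnegative and equal to `α² > 0` at the origin, and the law
charges every nonempty open set. Only positivity of the variance information matters, so its value
is left uncomputed. -/
theorem integral_affine_sqNorm_sq_pos (hv : 0 < v) {α : ℝ} (hα : α ≠ 0) (β : ℝ) :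
    0 < ∫ z, (α + β * sqNorm z) * (α + β * sqNorm z) ∂whiteNoise ι κ v := by
  have := isOpenPosMeasure_whiteNoise (ι := ι) (κ := κ) hv
  have hL := memLp_affine_sqNorm_whiteNoise (ι := ι) (κ := κ) hv α β
  have hc := continuous_sqNorm (ι := ι) (κ := κ)
  refine integral_pos_of_integrable_nonneg_nonzero (x := 0) (by fun_prop)
    (hL.integrable_mul hL) (fun z => mul_self_nonneg _) ?_
  simpa [sqNorm] using hα

end whiteNoise

/-! ### Derivatives of the noise-free data -/

section derivatives

variable {K L M P N : ℕ}

@[simp] theorem phasesOf_paramVec (φ : Fin K → ℝ) (s : Fin N → Fin K → ℂ) :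
    phasesOf (paramVec φ s) = φ := rfl

@[simp] theorem signalsOf_paramVec (φ : Fin K → ℝ) (s : Fin N → Fin K → ℂ) :
    signalsOf (paramVec φ s) = s := rfl

theorem hasDerivAt_unionMatrix_update {a : ℝ → Fin M → ℂ} (c : Fin P → Fin L) (Ω : Fin K → Fin L)
    {φ : Fin K → ℝ} {k : Fin K} (ha : DifferentiableAt ℝ a (φ k)) (i : Fin M × Fin P) :
    HasDerivAt (fun x => unionMatrix a c Ω (Function.update φ k x) i k)
      (unionDerivMatrix a c Ω φ i k) (φ k) := by
  have h := (hasDerivAt_pi.1 ha.hasDerivAt i.1).mul_const (activeSamplingMatrix c Ω i.2 k)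
  simpa [unionMatrix, unionDerivMatrix, khatriRao, arrayMatrix, arrayDerivMatrix] using h

theorem unionMatrix_update_of_ne (a : ℝ → Fin M → ℂ) (c : Fin P → Fin L) (Ω : Fin K → Fin L)
    (φ : Fin K → ℝ) {k k' : Fin K} (hk : k' ≠ k) (x : ℝ) (i : Fin M × Fin P) :
    unionMatrix a c Ω (Function.update φ k x) i k' = unionMatrix a c Ω φ i k' := by
  simp [unionMatrix, khatriRao, arrayMatrix, Function.update_of_ne hk]

theorem hasDerivAt_mean {a : ℝ → Fin M → ℂ} (c : Fin P → Fin L) (Ω : Fin K → Fin L)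
    {φ : Fin K → ℝ} (ha : ∀ k, DifferentiableAt ℝ a (φ k)) (s : Fin N → Fin K → ℂ)
    (p : ParamIdx K N) (f : Fin N) (i : Fin M × Fin P) :
    HasDerivAt (fun x => (unionMatrix a c Ω (phasesOf (Function.update (paramVec φ s) p x)) *ᵥ
        signalsOf (Function.update (paramVec φ s) p x) f) i)
      (meanJacobian a c Ω φ s (f, i) p) (paramVec φ s p) := by
  simp only [Matrix.mulVec, dotProduct]
  rcases p with k | q | q
  · have hφ : ∀ x, phasesOf (Function.update (paramVec φ s) (Sum.inl k) x) =
        Function.update φ k x := fun x => by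
      ext k'
      by_cases h : k' = k
      · subst h; simp [phasesOf]
      · simp [phasesOf, h, paramVec]
    have hs : ∀ x, signalsOf (Function.update (paramVec φ s) (Sum.inl k) x) = s := fun x => by
      ext f k'; simp [signalsOf, paramVec]
    simp only [hφ, hs]
    -- The Jacobian entry is written as a sum with a single nonzero term, to match termwise
    -- differentiation of the matrix product.
    have hd : meanJacobian a c Ω φ s (f, i) (Sum.inl k) =
        ∑ k', if k' = k then unionDerivMatrix a c Ω φ i k * s f k else 0 := by
      simp [meanJacobian, phaseJacobian, mul_comm]
    rw [hd]
    refine HasDerivAt.fun_sum fun k' _ => ?_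
    split_ifs with h
    · subst h
      exact (hasDerivAt_unionMatrix_update c Ω (ha k') i).mul_const _
    · simp only [unionMatrix_update_of_ne a c Ω φ h]
      exact hasDerivAt_const _ _
  · have hφ : ∀ x, phasesOf (Function.update (paramVec φ s) (Sum.inr (Sum.inl q)) x) = φ :=
      fun x => by ext k'; simp [phasesOf, paramVec]
    have hs : ∀ x k', signalsOf (Function.update (paramVec φ s) (Sum.inr (Sum.inl q)) x) f k' =
        if (f, k') = q then (x : ℂ) + (s f k').im * Complex.I else s f k' := fun x k' => by
      by_cases h : (f, k') = q
      · subst h; apply Complex.ext <;> simp [signalsOf, paramVec]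
      · apply Complex.ext <;> simp [signalsOf, paramVec, h]
    simp only [hφ, hs]
    have hd : meanJacobian a c Ω φ s (f, i) (Sum.inr (Sum.inl q)) =
        ∑ k', unionMatrix a c Ω φ i k' * if (f, k') = q then 1 else 0 := by
      obtain ⟨f', k⟩ := q
      by_cases h : f = f' <;> simp [meanJacobian, signalJacobian, h]
    rw [hd]
    refine HasDerivAt.fun_sum fun k' _ => HasDerivAt.const_mul _ ?_
    split_ifs with h
    · exact Complex.ofRealCLM.hasDerivAt.add_const _
    · exact hasDerivAt_const _ _
  · have hφ : ∀ x, phasesOf (Function.update (paramVec φ s) (Sum.inr (Sum.inr q)) x) = φ :=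
      fun x => by ext k'; simp [phasesOf, paramVec]
    have hs : ∀ x k', signalsOf (Function.update (paramVec φ s) (Sum.inr (Sum.inr q)) x) f k' =
        if (f, k') = q then ((s f k').re : ℂ) + x * Complex.I else s f k' := fun x k' => by
      by_cases h : (f, k') = q
      · subst h; apply Complex.ext <;> simp [signalsOf, paramVec]
      · apply Complex.ext <;> simp [signalsOf, paramVec, h]
    simp only [hφ, hs]
    have hd : meanJacobian a c Ω φ s (f, i) (Sum.inr (Sum.inr q)) =
        ∑ k', unionMatrix a c Ω φ i k' * if (f, k') = q then 1 * Complex.I else 0 := by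
      obtain ⟨f', k⟩ := q
      by_cases h : f = f' <;> simp [meanJacobian, signalJacobian, h, mul_comm]
    rw [hd]
    refine HasDerivAt.fun_sum fun k' _ => HasDerivAt.const_mul _ ?_
    split_ifs with h
    · exact (Complex.ofRealCLM.hasDerivAt.mul_const _).const_add _
    · exact hasDerivAt_const _ _

end derivatives

/-! ### Scores and Fisher information -/

section fisher

variable {K L M P N : ℕ}

/-- The noise-free data `G_S s(f)`. -/
def noiseFreeData (a : ℝ → Fin M → ℂ) (c : Fin P → Fin L) (Ω : Fin K → Fin L)
    (φ : Fin K → ℝ) (s : Fin N → Fin K → ℂ) : Fin N → Fin M × Fin P → ℂ :=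
  fun f => unionMatrix a c Ω φ *ᵥ s f

/-- Real Gram matrix of the derivatives of the noise-free data. -/
def realGram (a : ℝ → Fin M → ℂ) (c : Fin P → Fin L) (Ω : Fin K → Fin L)
    (φ : Fin K → ℝ) (s : Fin N → Fin K → ℂ) : Matrix (ParamIdx K N) (ParamIdx K N) ℝ :=
  ((meanJacobian a c Ω φ s)ᴴ * meanJacobian a c Ω φ s).map Complex.re

theorem hasDerivAt_logLikKnownVar {a : ℝ → Fin M → ℂ} (c : Fin P → Fin L) (Ω : Fin K → Fin L)
    (v : ℝ) {φ : Fin K → ℝ} (ha : ∀ k, DifferentiableAt ℝ a (φ k)) (s : Fin N → Fin K → ℂ)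
    (p : ParamIdx K N) (y : Fin N → Fin M × Fin P → ℂ) :
    HasDerivAt (fun x => logLikKnownVar a c Ω v (Function.update (paramVec φ s) p x) y)
      (2 * v⁻¹ * realInner (y - noiseFreeData a c Ω φ s) fun x => meanJacobian a c Ω φ s x p)
      (paramVec φ s p) := by
  have h : ∀ f i, HasDerivAt (fun x => ‖y f i -
      (unionMatrix a c Ω (phasesOf (Function.update (paramVec φ s) p x)) *ᵥ
        signalsOf (Function.update (paramVec φ s) p x) f) i‖ ^ 2)
      (-2 * (star (y f i - noiseFreeData a c Ω φ s f i) *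
        meanJacobian a c Ω φ s (f, i) p).re) (paramVec φ s p) := fun f i => by
    have h1 := ((hasDerivAt_mean c Ω ha s p f i).const_sub (y f i)).norm_sq
    rw [Function.update_eq_self] at h1
    convert h1 using 1
    rw [inner_neg_right, Complex.inner]
    simp only [phasesOf_paramVec, signalsOf_paramVec, noiseFreeData]
    rw [starRingEnd_apply, mul_comm (star _)]
    ring
  have h2 := ((HasDerivAt.fun_sum (u := Finset.univ) fun f _ =>
    HasDerivAt.fun_sum (u := Finset.univ) fun i _ => h f i).const_mul
    v⁻¹).const_sub (-((N : ℝ) * M * P) * Real.log (Real.pi * v))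
  refine h2.congr_deriv ?_
  simp only [realInner, ← Finset.mul_sum, Pi.sub_apply]
  ring

theorem hasDerivAt_logLikelihood_var (a : ℝ → Fin M → ℂ) (c : Fin P → Fin L)
    (Ω : Fin K → Fin L) {v : ℝ} (hv : 0 < v) (φ : Fin K → ℝ) (s : Fin N → Fin K → ℂ)
    (y : Fin N → Fin M × Fin P → ℂ) :
    HasDerivAt (fun x => logLikelihood a c Ω x φ s y)
      (-((N : ℝ) * M * P) * v⁻¹ + (v ^ 2)⁻¹ * sqNorm (y - noiseFreeData a c Ω φ s)) v := by
  have h1 : HasDerivAt (fun x : ℝ => Real.log (Real.pi * x)) v⁻¹ v := by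
    have h := ((hasDerivAt_id v).const_mul Real.pi).log (by simp [Real.pi_ne_zero, hv.ne'])
    exact h.congr_deriv (by rw [mul_one, id, div_mul_cancel_left₀ Real.pi_ne_zero])
  have h2 := (h1.const_mul (-((N : ℝ) * M * P))).sub
    ((hasDerivAt_inv hv.ne').mul_const (sqNorm (y - noiseFreeData a c Ω φ s)))
  exact h2.congr_deriv (by ring)

theorem score_logLikKnownVar {a : ℝ → Fin M → ℂ} (c : Fin P → Fin L) (Ω : Fin K → Fin L)
    (v : ℝ) {φ : Fin K → ℝ} (ha : ∀ k, DifferentiableAt ℝ a (φ k)) (s : Fin N → Fin K → ℂ)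
    (p : ParamIdx K N) (y : Fin N → Fin M × Fin P → ℂ) :
    score (logLikKnownVar a c Ω v) (paramVec φ s) p y =
      2 * v⁻¹ * realInner (y - noiseFreeData a c Ω φ s) fun x => meanJacobian a c Ω φ s x p :=
  (hasDerivAt_logLikKnownVar c Ω v ha s p y).deriv

theorem logLikUnknownVar_update_inl (a : ℝ → Fin M → ℂ) (c : Fin P → Fin L) (Ω : Fin K → Fin L)
    (v : ℝ) (θ : ParamIdx K N → ℝ) (p : ParamIdx K N) (x : ℝ) (y : Fin N → Fin M × Fin P → ℂ) :
    logLikUnknownVar a c Ω (Function.update (Sum.elim θ fun _ => v) (Sum.inl p) x) y =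
      logLikKnownVar a c Ω v (Function.update θ p x) y := by
  rw [Sum.update_elim_inl]
  rfl

theorem logLikUnknownVar_update_inr (a : ℝ → Fin M → ℂ) (c : Fin P → Fin L) (Ω : Fin K → Fin L)
    (v : ℝ) (φ : Fin K → ℝ) (s : Fin N → Fin K → ℂ) (u : Unit) (x : ℝ)
    (y : Fin N → Fin M × Fin P → ℂ) :
    logLikUnknownVar a c Ω (Function.update (Sum.elim (paramVec φ s) fun _ => v) (Sum.inr u) x) y =
      logLikelihood a c Ω x φ s y := by
  rw [Sum.update_elim_inr]
  simp only [logLikUnknownVar, logLikKnownVar, Sum.elim_inr, Sum.elim_inl, Function.update_self]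
  rfl

theorem score_logLikUnknownVar_inl {a : ℝ → Fin M → ℂ} (c : Fin P → Fin L) (Ω : Fin K → Fin L)
    (v : ℝ) {φ : Fin K → ℝ} (ha : ∀ k, DifferentiableAt ℝ a (φ k)) (s : Fin N → Fin K → ℂ)
    (p : ParamIdx K N) (y : Fin N → Fin M × Fin P → ℂ) :
    score (logLikUnknownVar a c Ω) (Sum.elim (paramVec φ s) fun _ => v) (Sum.inl p) y =
      2 * v⁻¹ * realInner (y - noiseFreeData a c Ω φ s) fun x => meanJacobian a c Ω φ s x p := by
  rw [← score_logLikKnownVar c Ω v ha s p y, score, score]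
  simp only [logLikUnknownVar_update_inl, Sum.elim_inl]

theorem score_logLikUnknownVar_inr (a : ℝ → Fin M → ℂ) (c : Fin P → Fin L) (Ω : Fin K → Fin L)
    {v : ℝ} (hv : 0 < v) (φ : Fin K → ℝ) (s : Fin N → Fin K → ℂ) (u : Unit)
    (y : Fin N → Fin M × Fin P → ℂ) :
    score (logLikUnknownVar a c Ω) (Sum.elim (paramVec φ s) fun _ => v) (Sum.inr u) y =
      -((N : ℝ) * M * P) * v⁻¹ + (v ^ 2)⁻¹ * sqNorm (y - noiseFreeData a c Ω φ s) := by
  rw [score]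
  simp only [logLikUnknownVar_update_inr, Sum.elim_inr]
  exact (hasDerivAt_logLikelihood_var a c Ω hv φ s y).deriv

/-- The residual `Y(f) - G_S s(f)` is white noise. -/
theorem measurePreserving_residual (a : ℝ → Fin M → ℂ) {c : Fin P → Fin L} (hc : c.Injective)
    (Ω : Fin K → Fin L) {v : ℝ} (hv : 0 < v) (φ : Fin K → ℝ) (s : Fin N → Fin K → ℂ) :
    MeasurePreserving (fun y => y - noiseFreeData a c Ω φ s)
    (observationLaw a c Ω v φ s) (whiteNoise (Fin N) (Fin M × Fin P) v) := by
  refine ⟨by fun_prop, ?_⟩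
  rw [observationLaw_eq_map a hc Ω hv, Measure.map_map (by fun_prop) (by fun_prop)]
  have h : ((fun y => y - noiseFreeData a c Ω φ s) ∘ fun z f => unionMatrix a c Ω φ *ᵥ s f + z f) =
      id := by
    ext z f i
    simp [noiseFreeData]
  rw [h, Measure.map_id]

theorem integral_residual (a : ℝ → Fin M → ℂ) {c : Fin P → Fin L} (hc : c.Injective)
    (Ω : Fin K → Fin L) {v : ℝ} (hv : 0 < v) (φ : Fin K → ℝ) (s : Fin N → Fin K → ℂ)
    {F : (Fin N → Fin M × Fin P → ℂ) → ℝ} (hF : Continuous F) :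
    ∫ y, F (y - noiseFreeData a c Ω φ s) ∂observationLaw a c Ω v φ s =
      ∫ z, F z ∂whiteNoise (Fin N) (Fin M × Fin P) v := by
  have h := measurePreserving_residual a hc Ω hv φ s
  rw [← h.map_eq, integral_map h.measurable.aemeasurable hF.aestronglyMeasurable]

theorem integrable_mul_residual (a : ℝ → Fin M → ℂ) {c : Fin P → Fin L} (hc : c.Injective)
    (Ω : Fin K → Fin L) {v : ℝ} (hv : 0 < v) (φ : Fin K → ℝ) (s : Fin N → Fin K → ℂ)
    {F F' : (Fin N → Fin M × Fin P → ℂ) → ℝ}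
    (hF : MemLp F 2 (whiteNoise (Fin N) (Fin M × Fin P) v))
    (hF' : MemLp F' 2 (whiteNoise (Fin N) (Fin M × Fin P) v)) :
    Integrable (fun y => F (y - noiseFreeData a c Ω φ s) * F' (y - noiseFreeData a c Ω φ s))
      (observationLaw a c Ω v φ s) :=
  (measurePreserving_residual a hc Ω hv φ s).integrable_comp_of_integrable (hF.integrable_mul hF')

/-- Two score factors `2/v` against the covariance factor `v/2` leave `2/v`. -/
theorem integral_phaseScore_mul_phaseScore {ι κ : Type*} [Fintype ι] [Fintype κ] {v : ℝ}
    (hv : 0 < v) (d e : ι × κ → ℂ) :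
    ∫ z, 2 * v⁻¹ * realInner z d * (2 * v⁻¹ * realInner z e) ∂whiteNoise ι κ v =
      2 * v⁻¹ * (star d ⬝ᵥ e).re := by
  simp_rw [mul_mul_mul_comm (2 * v⁻¹)]
  rw [integral_const_mul, integral_realInner_mul_realInner_whiteNoise hv]
  field_simp

theorem realGram_apply (a : ℝ → Fin M → ℂ) (c : Fin P → Fin L) (Ω : Fin K → Fin L)
    (φ : Fin K → ℝ) (s : Fin N → Fin K → ℂ) (p q : ParamIdx K N) :
    realGram a c Ω φ s p q = (star (fun x => meanJacobian a c Ω φ s x p) ⬝ᵥ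
      fun x => meanJacobian a c Ω φ s x q).re :=
  rfl

theorem fisherInformation_knownVar {a : ℝ → Fin M → ℂ} {c : Fin P → Fin L} (hc : c.Injective)
    (Ω : Fin K → Fin L) {v : ℝ} (hv : 0 < v) {φ : Fin K → ℝ}
    (ha : ∀ k, DifferentiableAt ℝ a (φ k)) (s : Fin N → Fin K → ℂ) :
    fisherInformation (lawKnownVar a c Ω v) (logLikKnownVar a c Ω v) (paramVec φ s) =
      (2 * v⁻¹) • realGram a c Ω φ s := by
  ext p q
  simp only [fisherInformation, Matrix.of_apply, score_logLikKnownVar c Ω v ha s]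
  rw [Matrix.smul_apply, realGram_apply, smul_eq_mul, ← integral_phaseScore_mul_phaseScore hv]
  exact integral_residual a hc Ω hv φ s (F := fun z => 2 * v⁻¹ * realInner z _ *
    (2 * v⁻¹ * realInner z _))
    ((continuous_const.mul (continuous_realInner _)).mul
      (continuous_const.mul (continuous_realInner _)))

/-- With unknown noise variance the Fisher information is block diagonal. -/
theorem fisherInformation_unknownVar {a : ℝ → Fin M → ℂ} {c : Fin P → Fin L} (hc : c.Injective)
    (Ω : Fin K → Fin L) {v : ℝ} (hv : 0 < v) {φ : Fin K → ℝ}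
    (ha : ∀ k, DifferentiableAt ℝ a (φ k)) (s : Fin N → Fin K → ℂ)
    (hNMP : (N : ℝ) * M * P ≠ 0) :
    ∃ γ : ℝ, 0 < γ ∧ fisherInformation (lawUnknownVar a c Ω) (logLikUnknownVar a c Ω)
      (Sum.elim (paramVec φ s) fun _ => v) =
      Matrix.fromBlocks ((2 * v⁻¹) • realGram a c Ω φ s) 0 0 (γ • (1 : Matrix Unit Unit ℝ)) := by
  set α := -((N : ℝ) * M * P) * v⁻¹ with hα
  set β := (v ^ 2)⁻¹ with hβ
  have hα0 : α ≠ 0 := mul_ne_zero (neg_ne_zero.2 hNMP) (inv_ne_zero hv.ne')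
  have hcr : ∀ d, Continuous fun z : Fin N → Fin M × Fin P → ℂ => 2 * v⁻¹ * realInner z d :=
    fun d => continuous_const.mul (continuous_realInner d)
  have hcs : Continuous fun z : Fin N → Fin M × Fin P → ℂ => α + β * sqNorm z :=
    continuous_const.add (continuous_const.mul continuous_sqNorm)
  have h0 : ∀ d : Fin N × Fin M × Fin P → ℂ, ∫ z, 2 * v⁻¹ * realInner z d * (α + β * sqNorm z)
      ∂whiteNoise (Fin N) (Fin M × Fin P) v = 0 := fun d => by
    simp_rw [mul_assoc (2 * v⁻¹)]
    rw [integral_const_mul, integral_realInner_mul_sqNorm_whiteNoise hv, mul_zero]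
  -- The witness is the second moment of the variance score; its constant term `-NMP/v` is nonzero,
  -- which makes it positive.
  refine ⟨_, integral_affine_sqNorm_sq_pos (ι := Fin N) (κ := Fin M × Fin P) hv hα0 β, ?_⟩
  ext (p | u) (q | w)
  · simp only [fisherInformation, Matrix.of_apply, score_logLikUnknownVar_inl c Ω v ha s,
      Matrix.fromBlocks_apply₁₁]
    rw [Matrix.smul_apply, realGram_apply, smul_eq_mul, ← integral_phaseScore_mul_phaseScore hv]
    exact integral_residual a hc Ω hv φ s ((hcr _).mul (hcr _))
  · simp only [fisherInformation, Matrix.of_apply, score_logLikUnknownVar_inl c Ω v ha s,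
      score_logLikUnknownVar_inr a c Ω hv, Matrix.fromBlocks_apply₁₂, Matrix.zero_apply]
    exact (integral_residual a hc Ω hv φ s ((hcr _).mul hcs)).trans (h0 _)
  · simp only [fisherInformation, Matrix.of_apply, score_logLikUnknownVar_inl c Ω v ha s,
      score_logLikUnknownVar_inr a c Ω hv, Matrix.fromBlocks_apply₂₁, Matrix.zero_apply]
    simp_rw [mul_comm (_ + _)]
    exact (integral_residual a hc Ω hv φ s ((hcr _).mul hcs)).trans (h0 _)
  · simp only [fisherInformation, Matrix.of_apply, score_logLikUnknownVar_inr a c Ω hv,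
      Matrix.fromBlocks_apply₂₂, Matrix.smul_apply, Matrix.one_apply_eq, smul_eq_mul, mul_one]
    exact integral_residual a hc Ω hv φ s (hcs.mul hcs)

/-! ### Inversion of the Fisher matrix and the resulting bounds -/

theorem realGram_inv {a : ℝ → Fin M → ℂ} {c : Fin P → Fin L} (Ω : Fin K → Fin L) {φ : Fin K → ℝ}
    (s : Fin N → Fin K → ℂ) (hN : N ≠ 0)
    (hG : IsUnit ((unionMatrix a c Ω φ)ᴴ * unionMatrix a c Ω φ).det)
    (hJ : IsUnit (infoMatrix a c Ω φ (subAutocorrelation s)ᵀ).det) :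
    IsUnit (realGram a c Ω φ s).det ∧ ((realGram a c Ω φ s)⁻¹).submatrix Sum.inl Sum.inl =
      ((N : ℝ) • infoMatrix a c Ω φ (subAutocorrelation s)ᵀ)⁻¹ := by
  have hN' : IsUnit (N : ℝ) := (Nat.cast_ne_zero.2 hN).isUnit
  rw [← phaseJacobian_schur a c Ω φ s hN]
  refine inv_realGram_submatrix _ _ (isUnit_det_signalJacobian_gram N a c Ω φ hG) ?_
  rw [phaseJacobian_schur a c Ω φ s hN, Matrix.det_smul]
  exact (hN'.pow _).mul hJ

theorem inv_smul_of_ne_zero {n : Type*} [Fintype n] [DecidableEq n] {r : ℝ} (hr : r ≠ 0)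
    {A : Matrix n n ℝ} (hA : IsUnit A.det) : (r • A)⁻¹ = r⁻¹ • A⁻¹ := by
  refine Matrix.inv_eq_left_inv ?_
  rw [Matrix.smul_mul, Matrix.mul_smul, smul_smul, Matrix.nonsing_inv_mul _ hA,
    inv_mul_cancel₀ hr, one_smul]

theorem fisherRegular_knownVar {a : ℝ → Fin M → ℂ} {c : Fin P → Fin L} (hc : c.Injective)
    (Ω : Fin K → Fin L) {v : ℝ} (hv : 0 < v) {φ : Fin K → ℝ}
    (ha : ∀ k, DifferentiableAt ℝ a (φ k)) (s : Fin N → Fin K → ℂ)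
    (hF : IsUnit (realGram a c Ω φ s).det) :
    FisherRegular (lawKnownVar a c Ω v) (logLikKnownVar a c Ω v) (paramVec φ s) := by
  refine ⟨fun y p => (hasDerivAt_logLikKnownVar c Ω v ha s p y).differentiableAt, fun p q => ?_, ?_⟩
  · simp only [score_logLikKnownVar c Ω v ha s]
    exact integrable_mul_residual a hc Ω hv φ s ((memLp_realInner_whiteNoise hv _).const_mul _)
      ((memLp_realInner_whiteNoise hv _).const_mul _)
  · rw [fisherInformation_knownVar hc Ω hv ha s, Matrix.det_smul]
    exact ((isUnit_iff_ne_zero.2 (by positivity)).pow _).mul hF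

theorem fisherRegular_unknownVar {a : ℝ → Fin M → ℂ} {c : Fin P → Fin L} (hc : c.Injective)
    (Ω : Fin K → Fin L) {v : ℝ} (hv : 0 < v) {φ : Fin K → ℝ}
    (ha : ∀ k, DifferentiableAt ℝ a (φ k)) (s : Fin N → Fin K → ℂ)
    (hNMP : (N : ℝ) * M * P ≠ 0) (hF : IsUnit (realGram a c Ω φ s).det) :
    FisherRegular (lawUnknownVar a c Ω) (logLikUnknownVar a c Ω)
      (Sum.elim (paramVec φ s) fun _ => v) := by
  have hr := fun p => (memLp_realInner_whiteNoise (ι := Fin N) (κ := Fin M × Fin P) hv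
    fun x => meanJacobian a c Ω φ s x p).const_mul (2 * v⁻¹)
  have hs := memLp_affine_sqNorm_whiteNoise (ι := Fin N) (κ := Fin M × Fin P) hv
    (-((N : ℝ) * M * P) * v⁻¹) (v ^ 2)⁻¹
  refine ⟨fun y p => ?_, fun p q => ?_, ?_⟩
  · rcases p with p | u
    · simp only [logLikUnknownVar_update_inl, Sum.elim_inl]
      exact (hasDerivAt_logLikKnownVar c Ω v ha s p y).differentiableAt
    · simp only [logLikUnknownVar_update_inr, Sum.elim_inr]
      exact (hasDerivAt_logLikelihood_var a c Ω hv φ s y).differentiableAt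
  · rcases p with p | u <;> rcases q with q | w <;>
      simp only [score_logLikUnknownVar_inl c Ω v ha s, score_logLikUnknownVar_inr a c Ω hv]
    · exact integrable_mul_residual a hc Ω hv φ s (hr p) (hr q)
    · exact integrable_mul_residual a hc Ω hv φ s (hr p) hs
    · exact integrable_mul_residual a hc Ω hv φ s hs (hr q)
    · exact integrable_mul_residual a hc Ω hv φ s hs hs
  · obtain ⟨γ, hγ, h⟩ := fisherInformation_unknownVar hc Ω hv ha s hNMP
    rw [h, Matrix.det_fromBlocks_zero₂₁, Matrix.det_smul, Matrix.det_smul, Matrix.det_one]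
    refine (((isUnit_iff_ne_zero.2 ?_).pow _).mul hF).mul ?_
    · positivity
    · simpa using hγ.ne'

theorem phaseCRBKnownVar_eq {a : ℝ → Fin M → ℂ} {c : Fin P → Fin L} (hc : c.Injective)
    (Ω : Fin K → Fin L) {v : ℝ} (hv : 0 < v) {φ : Fin K → ℝ}
    (ha : ∀ k, DifferentiableAt ℝ a (φ k)) (s : Fin N → Fin K → ℂ) (hN : N ≠ 0)
    (hG : IsUnit ((unionMatrix a c Ω φ)ᴴ * unionMatrix a c Ω φ).det)
    (hJ : IsUnit (infoMatrix a c Ω φ (subAutocorrelation s)ᵀ).det) :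
    phaseCRBKnownVar a c Ω v φ s =
      (v / (2 * N)) • (infoMatrix a c Ω φ (subAutocorrelation s)ᵀ)⁻¹ := by
  obtain ⟨hF, hinv⟩ := realGram_inv Ω s hN hG hJ
  have hN' : (N : ℝ) ≠ 0 := Nat.cast_ne_zero.2 hN
  rw [phaseCRBKnownVar, cramerRaoBound, fisherInformation_knownVar hc Ω hv ha s,
    inv_smul_of_ne_zero (by positivity) hF, Matrix.submatrix_smul, Pi.smul_apply, Pi.smul_apply,
    hinv, inv_smul_of_ne_zero hN' hJ, smul_smul]
  congr 1
  field_simp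

/-- A block-diagonal matrix is inverted blockwise, so the variance parameter leaves the phase block
untouched. -/
theorem phaseCRBUnknownVar_eq_known {a : ℝ → Fin M → ℂ} {c : Fin P → Fin L} (hc : c.Injective)
    (Ω : Fin K → Fin L) {v : ℝ} (hv : 0 < v) {φ : Fin K → ℝ}
    (ha : ∀ k, DifferentiableAt ℝ a (φ k)) (s : Fin N → Fin K → ℂ)
    (hNMP : (N : ℝ) * M * P ≠ 0) (hF : IsUnit (realGram a c Ω φ s).det) :
    phaseCRBUnknownVar a c Ω v φ s = phaseCRBKnownVar a c Ω v φ s := by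
  obtain ⟨γ, hγ, h⟩ := fisherInformation_unknownVar hc Ω hv ha s hNMP
  have hF' : IsUnit ((2 * v⁻¹) • realGram a c Ω φ s).det := by
    rw [Matrix.det_smul]
    exact ((isUnit_iff_ne_zero.2 (by positivity)).pow _).mul hF
  have hinv : (Matrix.fromBlocks ((2 * v⁻¹) • realGram a c Ω φ s) 0 0
      (γ • (1 : Matrix Unit Unit ℝ)))⁻¹ =
      Matrix.fromBlocks ((2 * v⁻¹) • realGram a c Ω φ s)⁻¹ 0 0 (γ⁻¹ • (1 : Matrix Unit Unit ℝ)) := by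
    refine Matrix.inv_eq_left_inv ?_
    rw [Matrix.fromBlocks_multiply, Matrix.nonsing_inv_mul _ hF']
    simp [smul_smul, mul_inv_cancel₀ hγ.ne', Matrix.fromBlocks_one]
  rw [phaseCRBUnknownVar, phaseCRBKnownVar, cramerRaoBound, cramerRaoBound, h, hinv,
    fisherInformation_knownVar hc Ω hv ha s]
  rfl

end fisher

/-! ### Autocorrelation matrices -/

section autocorrelation

variable {K L M P N : ℕ}

theorem infoMatrix_inv_natCast_smul (a : ℝ → Fin M → ℂ) (c : Fin P → Fin L) (Ω : Fin K → Fin L)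
    (φ : Fin K → ℝ) (n : ℕ) (R : Matrix (Fin K) (Fin K) ℂ) :
    infoMatrix a c Ω φ ((n : ℂ)⁻¹ • R) = (n : ℝ)⁻¹ • infoMatrix a c Ω φ R := by
  ext i j
  have h : (n : ℂ)⁻¹ = (((n : ℝ)⁻¹ : ℝ) : ℂ) := by simp
  simp only [infoMatrix, Matrix.map_apply, Matrix.hadamard_apply, Matrix.smul_apply, smul_eq_mul, h]
  rw [mul_left_comm, Complex.re_ofReal_mul]

theorem subAutocorrelation_isHermitian (s : Fin N → Fin K → ℂ) :
    (subAutocorrelation s).IsHermitian := by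
  ext i j
  simp [subAutocorrelation, Matrix.sum_apply, Matrix.vecMulVec_apply, mul_comm]

/-- Only the sub-band of signal `k` contributes to row `k`. For two signals sharing a sub-band the
identity holds outright; for different sub-bands the left side is zero, and diagonality makes the
right side zero too. -/
theorem nyquistAutocorrelation_eq (Ω : Fin K → Fin L) (s : Fin N → Fin K → ℂ)
    (hs : (subAutocorrelation s).IsDiag) :
    nyquistAutocorrelation Ω s = (L : ℂ)⁻¹ • subAutocorrelation s := by
  ext k k'
  have h1 : nyquistAutocorrelation Ω s k k' = ((L : ℂ) * N)⁻¹ *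
      if Ω k = Ω k' then ∑ f, s f k * star (s f k') else 0 := by
    simp only [nyquistAutocorrelation, Matrix.smul_apply, Matrix.sum_apply,
      Matrix.vecMulVec_apply, fullSpectrum, Pi.star_apply, smul_eq_mul, Fintype.sum_prod_type]
    rw [Finset.sum_eq_single (Ω k)]
    · by_cases h : Ω k = Ω k' <;> simp [h]
    · intro l _ hl
      simp [hl]
    · simp
  have h2 : subAutocorrelation s k k' = (N : ℂ)⁻¹ * ∑ f, s f k * star (s f k') := by
    simp [subAutocorrelation, Matrix.sum_apply, Matrix.vecMulVec_apply]
  rw [h1, Matrix.smul_apply, smul_eq_mul, mul_inv, mul_assoc]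
  congr 1
  split_ifs with h
  · exact h2.symm
  · rw [hs fun hk => h (by rw [hk]), mul_zero]

/-- An autocorrelation is Hermitian, and a diagonal matrix is symmetric, so both transposes return
the matrix itself. -/
theorem subAutocorrelation_conjTranspose_eq_transpose (s : Fin N → Fin K → ℂ)
    (hs : (subAutocorrelation s).IsDiag) :
    (subAutocorrelation s)ᴴ = (subAutocorrelation s)ᵀ := by
  rw [subAutocorrelation_isHermitian]
  exact (hs.isSymm).symm

end autocorrelation

end SubNyquist

end

/-! ### The theorem -/

theorem mainTheorem2 (K L M P N T : ℕ) (hK : 0 < K) (hT : T = L * N)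
    (a : ℝ → Fin M → ℂ) (c : Fin P → Fin L) (hc : StrictMono c) (Ω : Fin K → Fin L)
    (φ : Fin K → ℝ) (s : Fin N → Fin K → ℂ) (σ : ℝ) (hσ : 0 < σ)
    (ha : ∀ k, DifferentiableAt ℝ a (φ k))
    (hG : IsUnit ((unionMatrix a c Ω φ)ᴴ * unionMatrix a c Ω φ).det)
    (hJ : IsUnit (infoMatrix a c Ω φ (subAutocorrelation s)ᵀ).det) :
    -- the data law has the stated log-likelihood, for all parameter values
    (∀ (v : ℝ) (φ' : Fin K → ℝ) (s' : Fin N → Fin K → ℂ), 0 < v →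
      observationLaw a c Ω v φ' s' =
        volume.withDensity fun y => ENNReal.ofReal (Real.exp (logLikelihood a c Ω v φ' s' y))) ∧
    -- the `k`-th column of `E` is the derivative of the `k`-th column of `G_S` in `φ_k`
    (∀ k, HasDerivAt (fun x i => unionMatrix a c Ω (Function.update φ k x) i k)
      (fun i => unionDerivMatrix a c Ω φ i k) (φ k)) ∧
    -- the Fisher information is well defined and nonsingular
    FisherRegular (lawKnownVar a c Ω (σ ^ 2)) (logLikKnownVar a c Ω (σ ^ 2)) (paramVec φ s) ∧
    FisherRegular (lawUnknownVar a c Ω) (logLikUnknownVar a c Ω)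
      (Sum.elim (paramVec φ s) fun _ => σ ^ 2) ∧
    -- the Cramér-Rao bound for the phases, with known or unknown noise variance
    phaseCRBUnknownVar a c Ω (σ ^ 2) φ s = phaseCRBKnownVar a c Ω (σ ^ 2) φ s ∧
    phaseCRBKnownVar a c Ω (σ ^ 2) φ s =
      (σ ^ 2 / (2 * ((T : ℝ) / L))) • (infoMatrix a c Ω φ (subAutocorrelation s)ᵀ)⁻¹ ∧
    phaseCRBKnownVar a c Ω (σ ^ 2) φ s =
      (σ ^ 2 / (2 * T)) • (infoMatrix a c Ω φ ((L : ℂ)⁻¹ • subAutocorrelation s)ᵀ)⁻¹ ∧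
    -- uncorrelated signals
    ((subAutocorrelation s).IsDiag →
      nyquistAutocorrelation Ω s = (L : ℂ)⁻¹ • subAutocorrelation s ∧
      phaseCRBKnownVar a c Ω (σ ^ 2) φ s =
        (σ ^ 2 / (2 * ((T : ℝ) / L))) • (infoMatrix a c Ω φ (subAutocorrelation s)ᴴ)⁻¹ ∧
      phaseCRBKnownVar a c Ω (σ ^ 2) φ s =
        (σ ^ 2 / (2 * T)) • (infoMatrix a c Ω φ (nyquistAutocorrelation Ω s)ᴴ)⁻¹) := by
  have hL : L ≠ 0 := fun h => by subst h; exact (Ω ⟨0, hK⟩).elim0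
  -- As `K > 0`, the zero matrix is singular. This forces `N`, `M` and `P` to be nonzero, since for
  -- each of them the value zero turns the information matrix into empty sums.
  have hinfo : infoMatrix a c Ω φ (subAutocorrelation s)ᵀ ≠ 0 := fun h => by
    have : Nonempty (Fin K) := ⟨⟨0, hK⟩⟩
    rw [h, Matrix.det_zero] at hJ
    exact not_isUnit_zero hJ
  have hN : N ≠ 0 := fun h => by
    subst h
    exact hinfo (by ext; simp [infoMatrix, subAutocorrelation])
  have hM : M ≠ 0 := fun h => by
    subst h
    exact hinfo (by ext; simp [infoMatrix, Matrix.mul_apply])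
  have hP : P ≠ 0 := fun h => by
    subst h
    exact hinfo (by ext; simp [infoMatrix, Matrix.mul_apply])
  have hL' : (L : ℝ) ≠ 0 := Nat.cast_ne_zero.2 hL
  have hNMP : (N : ℝ) * M * P ≠ 0 := by positivity
  have hv : 0 < σ ^ 2 := by positivity
  have hTN : (T : ℝ) = L * N := by rw [hT]; push_cast; ring
  obtain ⟨hF, -⟩ := realGram_inv Ω s hN hG hJ
  have hcrb := phaseCRBKnownVar_eq hc.injective Ω hv ha s hN hG hJ
  have hsub : phaseCRBKnownVar a c Ω (σ ^ 2) φ s =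
      (σ ^ 2 / (2 * ((T : ℝ) / L))) • (infoMatrix a c Ω φ (subAutocorrelation s)ᵀ)⁻¹ := by
    rw [hcrb, hTN, mul_div_cancel_left₀ _ hL']
  -- Inverting the factor `1/L` of the autocorrelation yields `L`, and `L/(2T) = 1/(2N)`.
  have hnyq : phaseCRBKnownVar a c Ω (σ ^ 2) φ s =
      (σ ^ 2 / (2 * T)) • (infoMatrix a c Ω φ ((L : ℂ)⁻¹ • subAutocorrelation s)ᵀ)⁻¹ := by
    rw [hcrb, Matrix.transpose_smul, infoMatrix_inv_natCast_smul,
      inv_smul_of_ne_zero (inv_ne_zero hL') hJ, inv_inv, smul_smul, hTN]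
    congr 1
    field_simp
  refine ⟨fun v φ' s' hv' => observationLaw_eq_withDensity a hc.injective Ω hv' φ' s',
    fun k => hasDerivAt_pi.2 fun i => hasDerivAt_unionMatrix_update c Ω (ha k) i,
    fisherRegular_knownVar hc.injective Ω hv ha s hF,
    fisherRegular_unknownVar hc.injective Ω hv ha s hNMP hF,
    phaseCRBUnknownVar_eq_known hc.injective Ω hv ha s hNMP hF, hsub, hnyq, fun hdiag => ?_⟩
  have hH := subAutocorrelation_conjTranspose_eq_transpose s hdiag
  have hR := nyquistAutocorrelation_eq Ω s hdiag
  refine ⟨hR, by rw [hH, hsub], ?_⟩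
  rw [hnyq, hR, Matrix.conjTranspose_smul, Matrix.transpose_smul, hH]
  simp
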